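/- Let $\mathbb K$ be a field of characteristic zero and let $n\in\mathbb Z$. A hairy graph is a finite connected graph (multiple edges and tadpoles are allowed) with at least one univalent vertex and no vertex of valence $0$ or $2$; a tadpole contributes $2$ to the valence of its vertex. The univalent vertices are called hair ends, an edge at a hair end is called a hair, and the vertices of valence at least $3$ are called internal. Give hair ends degree $-1$, internal vertices degree $n$ and edges (hairs included) degree $1-n$. Let $\mathrm{HGC}_{-1,n}$ be the graded $\mathbb K$-vector space of formal (possibly infinite) series, degree by degree, of hairy graphs with numbered internal vertices, edges and hair ends and with directed edges, modulo the relations that renumbering multiplies a graph by the sign of the induced permutation of the objects of odd degree (the hair ends and, if $n$ is even, the edges, or, if $n$ is odd, the internal vertices) and that reversing the direction of an edge multiplies a graph by $(-1)^n$. Let $\delta$ be the operation of degree $+1$ on $\mathrm{HGC}_{-1,n}$ that splits vertices: $\delta\Gamma=\frac12\sum_x\sum_S\Gamma_{x,S}$, where $x$ runs over the internal vertices of $\Gamma$, where $S$ runs over the subsets of the set of half-edges at $x$, and where $\Gamma_{x,S}$ arises from $\Gamma$ by adding a new internal vertex $y$ and a new edge from $x$ to $y$, both numbered first, and moving the half-edges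 in $S$ from $x$ to $y$; only the terms in which $x$ and $y$ have valence at least $3$ are kept. Let $\Delta$ be the operation of degree $+1$ on $\mathrm{HGC}_{-1,n}$ with $\Delta\Gamma=0$ if $\Gamma$ has exactly one hair end, and otherwise $$\Delta\Gamma=\sum_{j}\sum_{v}\pm\,\Gamma_{j\to v},$$ where $j$ runs over the hair ends of $\Gamma$, where $v$ runs over the internal vertices of $\Gamma$ other than the vertex from which the hair of $j$ originates, and where $\Gamma_{j\to v}$ arises from $\Gamma$ by deleting the hair end $j$ and attaching the freed end of its edge to $v$. The sign is the Koszul sign of moving $j$ to the front in the order that lists first the internal vertices, then the edges, then the hair ends. Then $$\Delta^2=0,\qquad \delta\Delta+\Delta\delta=0,\qquad (\delta+\Delta)^2=0,$$ so that $\delta+\Delta$ is a differential on $\mathrm{HGC}_{-1,n}$. -/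

import Mathlib

noncomputable section

namespace HairyGraph

/-- A labelled directed graph with internal vertices `Sum.inl v`, `v : Fin N`, with hair ends
(external vertices) `Sum.inr j`, `j : Fin h`, and with `k` edges (those of the hairs included).
The edge `e` runs from its half-edge `(e, false)` to its half-edge `(e, true)`; the graph is the
map that sends each half-edge to the vertex it is attached to. Multiple edges and tadpoles are
allowed. -/
abbrev LabelledGraph (N h k : ℕ) : Type := Fin k × Bool → Fin N ⊕ Fin h

/-- The graphs that span the hairy graph complex: connected, with at least one hair, all hair ends
univalent and all internal vertices at least trivalent (a tadpole contributes two to the valence).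
The graph that consists of one edge between two hair ends is one of them. -/
structure IsHairy {N h k : ℕ} (G : LabelledGraph N h k) : Prop where
  one_le_hairs : 1 ≤ h
  connected : (SimpleGraph.fromRel fun x y => ∃ e, G (e, false) = x ∧ G (e, true) = y).Connected
  univalent : ∀ j : Fin h, ∃! p, G p = Sum.inr j
  trivalent : ∀ v : Fin N, 3 ≤ (Finset.univ.filter fun p => G p = Sum.inl v).card

/-- `G'` arises from `G` by permuting the labels of the internal vertices by `σ`, of the hairs by
`ρ`, of the edges by `τ`, and by reversing the edges `e` with `φ e = true`. -/
def IsRelabelling {N h k : ℕ} (σ : Equiv.Perm (Fin N)) (ρ : Equiv.Perm (Fin h))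
    (τ : Equiv.Perm (Fin k)) (φ : Fin k → Bool) (G G' : LabelledGraph N h k) : Prop :=
  ∀ e b, G' (τ e, xor (φ e) b) = Sum.map σ ρ (G (e, b))

/-- The sign of a relabelling. Internal vertices have degree `n`, edges degree `1 - n` and hair
ends degree `-1`; permuting objects of odd degree produces the sign of the permutation. For odd `n`
the reversal of an edge produces a sign, too. -/
def relabelSign (n : ℤ) {N h k : ℕ} (σ : Equiv.Perm (Fin N)) (ρ : Equiv.Perm (Fin h))
    (τ : Equiv.Perm (Fin k)) (φ : Fin k → Bool) : ℤ :=
  (Equiv.Perm.sign ρ : ℤ) *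
    if Even n then (Equiv.Perm.sign τ : ℤ)
    else (Equiv.Perm.sign σ : ℤ) * ∏ e, if φ e then -1 else 1

/-- The relations `G' = ± G` whenever `G'` is a relabelling of `G`. -/
def relations (K : Type*) [Field K] (n : ℤ) (N h k : ℕ) :
    Submodule K ({G : LabelledGraph N h k // IsHairy G} →₀ K) :=
  Submodule.span K {x | ∃ σ ρ τ φ, ∃ G G' : {G : LabelledGraph N h k // IsHairy G},
    IsRelabelling σ ρ τ φ G.1 G'.1 ∧
      x = Finsupp.single G' 1 - (relabelSign n σ ρ τ φ : K) • Finsupp.single G 1}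

/-- The part of `HGC_{-1,n}` that is spanned by the graphs with `N` internal vertices, `h` hairs
and `k` edges. -/
abbrev GraphSpace (K : Type*) [Field K] (n : ℤ) (N h k : ℕ) : Type _ :=
  ({G : LabelledGraph N h k // IsHairy G} →₀ K) ⧸ relations K n N h k

open Classical in
/-- The element represented by a labelled graph; graphs outside the complex represent zero. -/
def cls (K : Type*) [Field K] (n : ℤ) {N h k : ℕ} (G : LabelledGraph N h k) :
    GraphSpace K n N h k :=
  if hG : IsHairy G then (relations K n N h k).mkQ (Finsupp.single ⟨G, hG⟩ 1) else 0

/-! ### Invariance under relabelling -/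

section Relabelling

variable {N h k : ℕ} {σ : Equiv.Perm (Fin N)} {ρ : Equiv.Perm (Fin h)}
  {τ : Equiv.Perm (Fin k)} {φ : Fin k → Bool} {G G' : LabelledGraph N h k}

/-- The permutation of the half-edges given by `τ` and `φ`. -/
def halfPerm (τ : Equiv.Perm (Fin k)) (φ : Fin k → Bool) : Equiv.Perm (Fin k × Bool) where
  toFun p := (τ p.1, xor (φ p.1) p.2)
  invFun p := (τ.symm p.1, xor (φ (τ.symm p.1)) p.2)
  left_inv p := by ext <;> simp
  right_inv p := by ext <;> simp

theorem IsRelabelling.apply_halfPerm (H : IsRelabelling σ ρ τ φ G G') (p : Fin k × Bool) :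
    G' (halfPerm τ φ p) = Sum.map σ ρ (G p) := H p.1 p.2

theorem IsRelabelling.eq_inl_iff (H : IsRelabelling σ ρ τ φ G G') (p : Fin k × Bool) (v : Fin N) :
    G' (halfPerm τ φ p) = Sum.inl (σ v) ↔ G p = Sum.inl v := by
  rw [H.apply_halfPerm]
  rcases G p with a | a <;> simp

theorem IsRelabelling.eq_inr_iff (H : IsRelabelling σ ρ τ φ G G') (p : Fin k × Bool) (j : Fin h) :
    G' (halfPerm τ φ p) = Sum.inr (ρ j) ↔ G p = Sum.inr j := by
  rw [H.apply_halfPerm]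
  rcases G p with a | a <;> simp

theorem IsRelabelling.symm (H : IsRelabelling σ ρ τ φ G G') :
    IsRelabelling σ.symm ρ.symm τ.symm (fun e => φ (τ.symm e)) G' G := by
  intro e b
  have h1 := H (τ.symm e) (xor (φ (τ.symm e)) b)
  simp only [Equiv.apply_symm_apply, ← Bool.xor_assoc, Bool.xor_self, Bool.false_xor] at h1
  rw [h1]
  rcases G (τ.symm e, xor (φ (τ.symm e)) b) with a | a <;> simp

theorem IsRelabelling.isHairy (H : IsRelabelling σ ρ τ φ G G') (hG : IsHairy G) :
    IsHairy G' where
  one_le_hairs := hG.one_le_hairs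
  connected := by
    let f : Fin N ⊕ Fin h ≃ Fin N ⊕ Fin h := Equiv.sumCongr σ ρ
    have hom : ∀ {x y}, (SimpleGraph.fromRel fun x y =>
        ∃ e, G (e, false) = x ∧ G (e, true) = y).Adj x y →
        (SimpleGraph.fromRel fun x y =>
        ∃ e, G' (e, false) = x ∧ G' (e, true) = y).Adj (f x) (f y) := by
      intro x y hxy
      rw [SimpleGraph.fromRel_adj] at hxy ⊢
      refine ⟨fun hc => hxy.1 (f.injective hc), ?_⟩
      have key : ∀ {x y}, (∃ e, G (e, false) = x ∧ G (e, true) = y) →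
          (∃ e, G' (e, false) = f x ∧ G' (e, true) = f y) ∨
          (∃ e, G' (e, false) = f y ∧ G' (e, true) = f x) := by
        rintro x y ⟨e, rfl, rfl⟩
        have h0 := H e false
        have h1 := H e true
        cases hφ : φ e
        · rw [hφ] at h0 h1
          exact Or.inl ⟨τ e, h0, h1⟩
        · rw [hφ] at h0 h1
          exact Or.inr ⟨τ e, h1, h0⟩
      rcases hxy.2 with h1 | h1
      · exact key h1
      · exact (key h1).symm
    exact hG.connected.map ⟨f, hom⟩ f.surjective
  univalent j := by
    obtain ⟨p, hp, hu⟩ := hG.univalent (ρ.symm j)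
    refine ⟨halfPerm τ φ p, ?_, fun q hq => ?_⟩
    · have := (H.eq_inr_iff p (ρ.symm j)).2 hp
      simpa using this
    · have := (H.eq_inr_iff ((halfPerm τ φ).symm q) (ρ.symm j)).1 (by simpa using hq)
      rw [← hu _ this]
      simp
  trivalent v := by
    refine (hG.trivalent (σ.symm v)).trans_eq ?_
    refine Finset.card_bijective (halfPerm τ φ) (halfPerm τ φ).bijective fun p => ?_
    have := H.eq_inl_iff p (σ.symm v)
    simp only [Equiv.apply_symm_apply] at this
    simp [this]

theorem cls_relabel (K : Type*) [Field K] (n : ℤ) (H : IsRelabelling σ ρ τ φ G G') :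
    cls K n G' = (relabelSign n σ ρ τ φ : K) • cls K n G := by
  by_cases hG : IsHairy G
  · have hG' := H.isHairy hG
    rw [cls, cls, dif_pos hG, dif_pos hG', ← map_smul, ← sub_eq_zero, ← map_sub,
      Submodule.mkQ_apply, Submodule.Quotient.mk_eq_zero]
    exact Submodule.subset_span ⟨σ, ρ, τ, φ, ⟨G, hG⟩, ⟨G', hG'⟩, H, rfl⟩
  · have hG' : ¬ IsHairy G' := fun hc => hG (H.symm.isHairy hc)
    rw [cls, cls, dif_neg hG, dif_neg hG', smul_zero]

end Relabelling

/-- A map on labelled graphs that is compatible with relabelling induces a linear map. -/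
def liftGraphs {K : Type*} [Field K] {n : ℤ} {N h k : ℕ} {M : Type*} [AddCommGroup M] [Module K M]
    (f : LabelledGraph N h k → M)
    (hf : ∀ σ ρ τ φ (G G' : LabelledGraph N h k), IsRelabelling σ ρ τ φ G G' →
      f G' = (relabelSign n σ ρ τ φ : K) • f G) :
    GraphSpace K n N h k →ₗ[K] M :=
  (relations K n N h k).liftQ (Finsupp.linearCombination K fun G => f G.1) (by
    rw [relations, Submodule.span_le]
    rintro x ⟨σ, ρ, τ, φ, G, G', H, rfl⟩
    simp [hf _ _ _ _ _ _ H])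

/-! ### The splitting differential -/

/-- Splitting the internal vertex `x`: a new internal vertex, with label `0`, and a new edge, with
label `0`, from `x` to the new vertex are inserted in front of the old ones, and the half-edges in
`S` are moved from `x` to the new vertex. -/
def split {N h k : ℕ} (G : LabelledGraph N h k) (x : Fin N) (S : Finset (Fin k × Bool)) :
    LabelledGraph (N + 1) h (k + 1) := fun p =>
  Fin.cases (if p.2 then Sum.inl 0 else Sum.inl x.succ)
    (fun e => if (e, p.2) ∈ S then Sum.inl 0 else Sum.map Fin.succ id (G (e, p.2))) p.1

/-- The sum over all splittings of an internal vertex that produce only vertices of valence at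
least three (the other ones represent zero). The sum is over all ways of distributing the half-edges
at `x` among two ordered vertices, hence the factor `1 / 2`. -/
def splitSum (K : Type*) [Field K] (n : ℤ) {N h k : ℕ} (G : LabelledGraph N h k) :
    GraphSpace K n (N + 1) h (k + 1) :=
  (1 / 2 : K) • ∑ x : Fin N,
    ∑ S ∈ (Finset.univ.filter fun p => G p = Sum.inl x).powerset, cls K n (split G x S)

/-- A permutation, extended by a new fixed first element. -/
def extendPerm {m : ℕ} (σ : Equiv.Perm (Fin m)) : Equiv.Perm (Fin (m + 1)) :=
  Equiv.Perm.decomposeFin.symm (0, σ)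

@[simp] theorem extendPerm_zero {m : ℕ} (σ : Equiv.Perm (Fin m)) : extendPerm σ 0 = 0 := by
  simp [extendPerm]

@[simp] theorem extendPerm_succ {m : ℕ} (σ : Equiv.Perm (Fin m)) (i : Fin m) :
    extendPerm σ i.succ = (σ i).succ := by
  simp [extendPerm]

@[simp] theorem sign_extendPerm {m : ℕ} (σ : Equiv.Perm (Fin m)) :
    Equiv.Perm.sign (extendPerm σ) = Equiv.Perm.sign σ := by
  simp [extendPerm]

theorem split_relabel {N h k : ℕ} {σ : Equiv.Perm (Fin N)} {ρ : Equiv.Perm (Fin h)}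
    {τ : Equiv.Perm (Fin k)} {φ : Fin k → Bool} {G G' : LabelledGraph N h k}
    (H : IsRelabelling σ ρ τ φ G G') (x : Fin N) (S : Finset (Fin k × Bool)) :
    IsRelabelling (extendPerm σ) ρ (extendPerm τ) (Fin.cons false φ) (split G x S)
      (split G' (σ x) (S.map (halfPerm τ φ).toEmbedding)) := by
  intro e b
  refine Fin.cases ?_ (fun e => ?_) e
  · cases b <;> simp [split]
  · have hmem : (τ e, xor (φ e) b) ∈ S.map (halfPerm τ φ).toEmbedding ↔ (e, b) ∈ S :=
      Finset.mem_map' (halfPerm τ φ).toEmbedding (a := (e, b))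
    by_cases hS : (e, b) ∈ S
    · simp only [split, extendPerm_succ, Fin.cons_succ, Fin.cases_succ, if_pos (hmem.2 hS),
        if_pos hS]
      simp
    · simp only [split, extendPerm_succ, Fin.cons_succ, Fin.cases_succ, if_neg (mt hmem.1 hS),
        if_neg hS, H e b]
      rcases G (e, b) with a | a <;> simp

theorem splitSum_relabel (K : Type*) [Field K] (n : ℤ) {N h k : ℕ} (σ : Equiv.Perm (Fin N))
    (ρ : Equiv.Perm (Fin h)) (τ : Equiv.Perm (Fin k)) (φ : Fin k → Bool)
    (G G' : LabelledGraph N h k) (H : IsRelabelling σ ρ τ φ G G') :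
    splitSum K n G' = (relabelSign n σ ρ τ φ : K) • splitSum K n G := by
  have hsign : relabelSign n (extendPerm σ) ρ (extendPerm τ) (Fin.cons false φ) =
      relabelSign n σ ρ τ φ := by
    simp [relabelSign, Fin.prod_univ_succ]
  rw [splitSum, splitSum, smul_comm]
  congr 1
  rw [Finset.smul_sum]
  rw [← Equiv.sum_comp σ (fun x => ∑ S ∈ (Finset.univ.filter fun p => G' p = Sum.inl x).powerset,
    cls K n (split G' x S))]
  refine Finset.sum_congr rfl fun x _ => ?_
  rw [Finset.smul_sum]
  symm
  refine Finset.sum_bij' (fun S _ => S.map (halfPerm τ φ).toEmbedding)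
    (fun S _ => S.map (halfPerm τ φ).symm.toEmbedding) ?_ ?_ ?_ ?_ ?_
  · intro S hS
    rw [Finset.mem_powerset] at hS ⊢
    intro q hq
    obtain ⟨p, hp, rfl⟩ := Finset.mem_map.1 hq
    have := (Finset.mem_filter.1 (hS hp)).2
    exact Finset.mem_filter.2 ⟨Finset.mem_univ _, (H.eq_inl_iff p x).2 this⟩
  · intro S hS
    rw [Finset.mem_powerset] at hS ⊢
    intro q hq
    obtain ⟨p, hp, rfl⟩ := Finset.mem_map.1 hq
    have := (Finset.mem_filter.1 (hS hp)).2
    refine Finset.mem_filter.2 ⟨Finset.mem_univ _, (H.eq_inl_iff _ x).1 ?_⟩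
    simpa using this
  · intro S _
    ext q
    simp
  · intro S _
    ext q
    simp
  · intro S _
    rw [cls_relabel K n (split_relabel H x S), hsign]

/-! ### Reconnecting a hair -/

/-- Reconnecting the hair `j` to the internal vertex `v`: the end `j` of the hair is removed, and
the half-edge that was attached to it is attached to `v`. -/
def reconnect {N h k : ℕ} (G : LabelledGraph N (h + 1) k) (j : Fin (h + 1)) (v : Fin N) :
    LabelledGraph N h k := fun p =>
  Sum.elim Sum.inl
    (Fin.insertNth (α := fun _ => Fin N ⊕ Fin h) j (Sum.inl v) (Sum.inr : Fin h → Fin N ⊕ Fin h))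
    (G p)

/-- The hair `j` originates from the internal vertex `v`. -/
def HairAt {N h k : ℕ} (G : LabelledGraph N h k) (j : Fin h) (v : Fin N) : Prop :=
  ∃ e b, G (e, b) = Sum.inr j ∧ G (e, !b) = Sum.inl v

/-- The sign of moving the hair end `j` to the front, in the order in which all internal vertices
are followed by all edges and then by all hair ends. -/
def reconnectSign (n : ℤ) (N k : ℕ) {h : ℕ} (j : Fin h) : ℤ :=
  (-1) ^ ((if Even n then k else N) + (j : ℕ))

open Classical in
/-- The sum over all ways of choosing a hair and reconnecting it to an internal vertex other than
the one from which it originates. -/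
def reconnectSum (K : Type*) [Field K] (n : ℤ) {N h k : ℕ} (G : LabelledGraph N (h + 1) k) :
    GraphSpace K n N h k :=
  ∑ j : Fin (h + 1), ∑ v ∈ Finset.univ.filter fun v : Fin N => ¬ HairAt G j v,
    (reconnectSign n N k j : K) • cls K n (reconnect G j v)

theorem exists_removePerm {h : ℕ} (ρ : Equiv.Perm (Fin (h + 1))) (j : Fin (h + 1)) :
    ∃ ρ' : Equiv.Perm (Fin h), (∀ i, ρ (j.succAbove i) = (ρ j).succAbove (ρ' i)) ∧
      (-1 : ℤ) ^ (ρ j : ℕ) * (Equiv.Perm.sign ρ' : ℤ) =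
        (Equiv.Perm.sign ρ : ℤ) * (-1) ^ (j : ℕ) := by
  obtain ⟨⟨a, ρ'⟩, hρ'⟩ := Equiv.Perm.decomposeFin.symm.surjective
    ((j.cycleRange.symm.trans ρ).trans (ρ j).cycleRange)
  have ha : a = 0 := by
    have := congrArg (fun f : Equiv.Perm (Fin (h + 1)) => f 0) hρ'
    simpa using this
  subst ha
  refine ⟨ρ', fun i => ?_, ?_⟩
  · have h1 := congrArg (fun f : Equiv.Perm (Fin (h + 1)) => (ρ j).cycleRange.symm (f i.succ)) hρ'
    simpa using h1.symm
  · have h1 := congrArg (fun f => ((Equiv.Perm.sign f : ℤˣ) : ℤ)) hρ'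
    simp only [Equiv.Perm.decomposeFin.symm_sign, if_true, one_mul, Equiv.Perm.sign_trans,
      Equiv.Perm.sign_symm, Fin.sign_cycleRange, Units.val_mul, Units.val_pow_eq_pow_val,
      Units.val_neg, Units.val_one] at h1
    rw [h1, ← mul_assoc, ← mul_assoc, ← mul_pow]
    simp

theorem reconnect_relabel {N h k : ℕ} {σ : Equiv.Perm (Fin N)} {ρ : Equiv.Perm (Fin (h + 1))}
    {τ : Equiv.Perm (Fin k)} {φ : Fin k → Bool} {G G' : LabelledGraph N (h + 1) k}
    (H : IsRelabelling σ ρ τ φ G G') (j : Fin (h + 1)) (v : Fin N) {ρ' : Equiv.Perm (Fin h)}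
    (hρ' : ∀ i, ρ (j.succAbove i) = (ρ j).succAbove (ρ' i)) :
    IsRelabelling σ ρ' τ φ (reconnect G j v) (reconnect G' (ρ j) (σ v)) := by
  intro e b
  simp only [reconnect, H e b]
  rcases G (e, b) with a | a
  · simp
  · refine Fin.succAboveCases j ?_ (fun i => ?_) a
    · simp
    · simp [hρ']

theorem hairAt_relabel {N h k : ℕ} {σ : Equiv.Perm (Fin N)} {ρ : Equiv.Perm (Fin h)}
    {τ : Equiv.Perm (Fin k)} {φ : Fin k → Bool} {G G' : LabelledGraph N h k}
    (H : IsRelabelling σ ρ τ φ G G') (j : Fin h) (v : Fin N) :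
    HairAt G' (ρ j) (σ v) ↔ HairAt G j v := by
  have key : ∀ e b, (G' (τ e, xor (φ e) b) = Sum.inr (ρ j) ∧
      G' (τ e, !(xor (φ e) b)) = Sum.inl (σ v)) ↔ (G (e, b) = Sum.inr j ∧ G (e, !b) = Sum.inl v) := by
    intro e b
    have h2 := H.eq_inl_iff (e, !b) v
    simp only [halfPerm, Equiv.coe_fn_mk, Bool.xor_not] at h2
    exact and_congr (H.eq_inr_iff (e, b) j) h2
  constructor
  · rintro ⟨e, b, hb⟩
    refine ⟨τ.symm e, xor (φ (τ.symm e)) b, (key _ _).1 ?_⟩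
    simpa using hb
  · rintro ⟨e, b, hb⟩
    exact ⟨_, _, (key e b).2 hb⟩

theorem reconnectSum_relabel (K : Type*) [Field K] (n : ℤ) {N h k : ℕ} (σ : Equiv.Perm (Fin N))
    (ρ : Equiv.Perm (Fin (h + 1))) (τ : Equiv.Perm (Fin k)) (φ : Fin k → Bool)
    (G G' : LabelledGraph N (h + 1) k) (H : IsRelabelling σ ρ τ φ G G') :
    reconnectSum K n G' = (relabelSign n σ ρ τ φ : K) • reconnectSum K n G := by
  classical
  rw [reconnectSum, reconnectSum, ← Equiv.sum_comp ρ, Finset.smul_sum]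
  refine Finset.sum_congr rfl fun j _ => ?_
  obtain ⟨ρ', h1, h2⟩ := exists_removePerm ρ j
  have hsign : reconnectSign n N k (ρ j) * relabelSign n σ ρ' τ φ =
      relabelSign n σ ρ τ φ * reconnectSign n N k j := by
    simp only [reconnectSign, relabelSign, pow_add]
    linear_combination ((-1) ^ (if Even n then k else N) * (if Even n then (Equiv.Perm.sign τ : ℤ)
      else (Equiv.Perm.sign σ : ℤ) * ∏ e, if φ e then -1 else 1)) * h2
  rw [Finset.smul_sum]
  symm
  refine Finset.sum_equiv σ (fun v => ?_) fun v _ => ?_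
  · simp only [Finset.mem_filter, Finset.mem_univ, true_and, hairAt_relabel H]
  · rw [cls_relabel K n (reconnect_relabel H j v h1), smul_smul, smul_smul, ← Int.cast_mul,
      ← Int.cast_mul, hsign]

end HairyGraph

open HairyGraph

/-- The degree of a graph with `N` internal vertices of degree `n`, `h` hair ends of degree `-1`
and `k` edges of degree `1 - n`. -/
def HairyGraph.degree (n : ℤ) (N h k : ℕ) : ℤ := n * N + (-1) * h + (1 - n) * k

/-- The homogeneous part of degree `d` of the hairy graph complex `HGC_{-1,n}`; its elements are
series of hairy graphs. The index is the triple of the numbers of internal vertices, of hairs and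
of edges. -/
abbrev HGC (K : Type*) [Field K] (n d : ℤ) : Type _ :=
  ∀ p : {p : ℕ × ℕ × ℕ // degree n p.1 p.2.1 p.2.2 = d}, GraphSpace K n p.1.1 p.1.2.1 p.1.2.2

namespace HGC

/-- Vertex splitting, on graphs with given numbers of vertices, hairs and edges. -/
def δgraph (K : Type*) [Field K] (n : ℤ) (N h k : ℕ) :
    GraphSpace K n N h k →ₗ[K] GraphSpace K n (N + 1) h (k + 1) :=
  liftGraphs (splitSum K n) (splitSum_relabel K n)

/-- Hair reconnection, on graphs with given numbers of vertices, hairs and edges. -/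
def Δgraph (K : Type*) [Field K] (n : ℤ) (N h k : ℕ) :
    GraphSpace K n N (h + 1) k →ₗ[K] GraphSpace K n N h k :=
  liftGraphs (reconnectSum K n) (reconnectSum_relabel K n)

/-- The differential `δ` of the hairy graph complex: the splitting of internal vertices. -/
def δ (K : Type*) [Field K] (n d : ℤ) : HGC K n d →ₗ[K] HGC K n (d + 1) where
  toFun x
    | ⟨(N + 1, h, k + 1), hd⟩ => δgraph K n N h k (x ⟨(N, h, k), by
        simp only [degree, Nat.cast_add, Nat.cast_one] at hd ⊢; linarith⟩)
    | ⟨(0, _, _), _⟩ => 0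
    | ⟨(_ + 1, _, 0), _⟩ => 0
  map_add' x y := by
    funext ⟨⟨N, h, k⟩, hd⟩
    rcases N with _ | N <;> rcases k with _ | k <;> simp
  map_smul' c x := by
    funext ⟨⟨N, h, k⟩, hd⟩
    rcases N with _ | N <;> rcases k with _ | k <;> simp

/-- The operation `Δ`: on graphs with at least two hairs, the sum over all ways of reconnecting one
hair to another vertex; on graphs with exactly one hair, zero. -/
def Δ (K : Type*) [Field K] (n d : ℤ) : HGC K n d →ₗ[K] HGC K n (d + 1) where
  toFun x
    | ⟨(N, h + 1, k), hd⟩ => Δgraph K n N (h + 1) k (x ⟨(N, h + 2, k), by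
        simp only [degree, Nat.cast_add, Nat.cast_one, Nat.cast_ofNat] at hd ⊢; linarith⟩)
    | ⟨(_, 0, _), _⟩ => 0
  map_add' x y := by
    funext ⟨⟨N, h, k⟩, hd⟩
    rcases h with _ | h <;> simp
  map_smul' c x := by
    funext ⟨⟨N, h, k⟩, hd⟩
    rcases h with _ | h <;> simp

end HGC

end

noncomputable section

namespace HairyGraph

/-! ### Graphs and their half-edges -/

/-! All three identities follow from matching graphs that agree up to relabelling and carry opposite
signs. Two relabellings do most of the work: `cls_swap_edges` exchanges two edges and reverses
exactly one of them, and `cls_swap_splittings` exchanges two edges together with two internal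
vertices. Both give the sign `-1` for either parity of `n`.

`Δ² = 0`: two hairs can be reconnected in either order, and hair ends are odd
(`Δgraph_comp_Δgraph`).

`δ² = 0`: a twofold splitting either splits two different vertices or replaces one vertex by a tree
with three vertices. Each such configuration arises in two ways that differ by `cls_swap_splittings`
(`sum_splittings_of_splittings`).

`δΔ + Δδ = 0`: apart from valence conditions, reconnecting and then splitting gives the same graphs
as splitting and then reconnecting (`sum_split_reconnect`). The sign is opposite because splitting
adds one odd vertex or edge in front of the hair ends (`reconnectSign_succ`). The extra terms, in
which a hair joins the two halves of its own vertex, have a double edge and cancel.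

The valence conditions leave a defect: a splitting with a bivalent vertex is forbidden before
reconnection, but a reconnected hair can make this vertex trivalent. What remains is the sum over
all attachments of a hair to the middle of an edge, and it vanishes (`sum_attach`). An edge between
internal vertices is counted from both ends with opposite signs. Attaching hair `j` to hair `i`
cancels against attaching `i` to `j`. The attachment of a hair to itself does not occur, since a
hair is never reconnected to its own vertex. -/

/-- The other half of the edge of a half-edge. -/
def opp {k : ℕ} (p : Fin k × Bool) : Fin k × Bool := (p.1, !p.2)

@[simp] theorem opp_opp {k : ℕ} (p : Fin k × Bool) : opp (opp p) = p := by simp [opp]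

theorem opp_ne {k : ℕ} (p : Fin k × Bool) : opp p ≠ p := fun hp => by
  have := congrArg Prod.snd hp
  simp [opp] at this

/-- The half-edges of the old edges, when a new first edge is added. -/
def oldHalf (k : ℕ) : Fin k × Bool ↪ Fin (k + 1) × Bool where
  toFun p := (p.1.succ, p.2)
  inj' := by rintro ⟨a, b⟩ ⟨c, d⟩ hp; simpa using hp

theorem oldHalf_apply {k : ℕ} (p : Fin k × Bool) : oldHalf k p = (p.1.succ, p.2) := rfl

@[simp] theorem opp_oldHalf {k : ℕ} (p : Fin k × Bool) :
    opp (oldHalf k p) = oldHalf k (opp p) := rfl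

theorem oldHalf_ne_zero {k : ℕ} (p : Fin k × Bool) (b : Bool) : oldHalf k p ≠ (0, b) := by
  simp [oldHalf_apply]

theorem zero_notMem_map_oldHalf {k : ℕ} (S : Finset (Fin k × Bool)) (b : Bool) :
    ((0, b) : Fin (k + 1) × Bool) ∉ S.map (oldHalf k) := by
  simp [oldHalf_ne_zero]

@[elab_as_elim]
theorem halfEdge_cases {k : ℕ} {P : Fin (k + 1) × Bool → Prop} (h0 : ∀ b, P (0, b))
    (h1 : ∀ p, P (oldHalf k p)) (p : Fin (k + 1) × Bool) : P p := by
  obtain ⟨e, b⟩ := p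
  exact Fin.cases (motive := fun e => P (e, b)) (h0 b) (fun e => h1 (e, b)) e

/-- The half-edges at an internal vertex. -/
abbrev halfEdgesAt {N h k : ℕ} (G : LabelledGraph N h k) (v : Fin N) : Finset (Fin k × Bool) :=
  Finset.univ.filter fun p => G p = Sum.inl v

/-- The simple graph whose connectedness is that of the labelled graph. -/
abbrev adjGraph {N h k : ℕ} (G : LabelledGraph N h k) : SimpleGraph (Fin N ⊕ Fin h) :=
  SimpleGraph.fromRel fun x y => ∃ e, G (e, false) = x ∧ G (e, true) = y

section Basic

variable {N h k N' h' k' : ℕ} {G : LabelledGraph N h k} {G' : LabelledGraph N' h' k'}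

theorem adjGraph_adj {x y : Fin N ⊕ Fin h} (hxy : (adjGraph G).Adj x y) :
    ∃ p, G p = x ∧ G (opp p) = y := by
  rw [SimpleGraph.fromRel_adj] at hxy
  obtain ⟨-, ⟨e, h1, h2⟩ | ⟨e, h1, h2⟩⟩ := hxy
  · exact ⟨(e, false), h1, h2⟩
  · exact ⟨(e, true), h2, h1⟩

theorem reachable_opp (G : LabelledGraph N h k) (p : Fin k × Bool) :
    (adjGraph G).Reachable (G p) (G (opp p)) := by
  by_cases hp : G p = G (opp p)
  · rw [← hp]
  · refine SimpleGraph.Adj.reachable ?_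
    rw [SimpleGraph.fromRel_adj]
    refine ⟨hp, ?_⟩
    obtain ⟨e, _ | _⟩ := p
    · exact Or.inl ⟨e, rfl, rfl⟩
    · exact Or.inr ⟨e, rfl, rfl⟩

/-- Adjacent vertices need only have images joined by a path, and `f` need only be onto up to paths.
This covers reconnecting a hair, contracting an edge and splitting a vertex alike. -/
theorem connected_of_map (hG : (adjGraph G).Connected) (f : Fin N ⊕ Fin h → Fin N' ⊕ Fin h')
    (hf : ∀ p, (adjGraph G').Reachable (f (G p)) (f (G (opp p))))
    (hs : ∀ w, ∃ v, (adjGraph G').Reachable (f v) w) : (adjGraph G').Connected := by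
  have key : ∀ {a b}, (adjGraph G).Reachable a b → (adjGraph G').Reachable (f a) (f b) := by
    rintro a b ⟨w⟩
    induction w with
    | nil => rfl
    | cons hab _ ih =>
      obtain ⟨p, rfl, rfl⟩ := adjGraph_adj hab
      exact (hf p).trans ih
  obtain ⟨v0⟩ := hG.nonempty
  refine @SimpleGraph.Connected.mk _ _ (fun a b => ?_) ⟨f v0⟩
  obtain ⟨a', ha⟩ := hs a
  obtain ⟨b', hb⟩ := hs b
  exact ha.symm.trans ((key (hG.preconnected a' b')).trans hb)

theorem mem_of_connected (hG : (adjGraph G).Connected) {C : Set (Fin N ⊕ Fin h)}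
    (hC : ∀ p, G p ∈ C → G (opp p) ∈ C) {a : Fin N ⊕ Fin h} (ha : a ∈ C) (b : Fin N ⊕ Fin h) :
    b ∈ C := by
  obtain ⟨w⟩ := hG.preconnected a b
  induction w with
  | nil => exact ha
  | cons hab _ ih =>
    obtain ⟨p, rfl, rfl⟩ := adjGraph_adj hab
    exact ih (hC p ha)

/-- The half-edge `p j` is the only one at the hair end `j`, and the hair `j` originates from the
internal vertex `u j`. -/
structure HairData (G : LabelledGraph N h k) (p : Fin h → Fin k × Bool) (u : Fin h → Fin N) :
    Prop where
  eq_inr_iff : ∀ q j, G q = Sum.inr j ↔ q = p j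
  opp_eq : ∀ j, G (opp (p j)) = Sum.inl (u j)

/-- An edge between two hair ends would be a whole component, which the internal vertex `v`
excludes. -/
theorem IsHairy.exists_hairData (hG : IsHairy G) (v : Fin N) : ∃ p u, HairData G p u := by
  choose p hp hu using hG.univalent
  have hiff : ∀ q j, G q = Sum.inr j ↔ q = p j := fun q j => ⟨hu j q, fun hq => hq ▸ hp j⟩
  have h1 : ∀ j, ∃ u, G (opp (p j)) = Sum.inl u := by
    intro j
    rcases hi : G (opp (p j)) with u | i
    · exact ⟨u, rfl⟩
    · exfalso
      have hpi := (hiff _ _).1 hi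
      have := mem_of_connected hG.connected (C := {Sum.inr i, Sum.inr j}) (a := Sum.inr j)
        (fun q hq => by
          rcases hq with hq | hq
          · rw [(hiff _ _).1 hq, ← hpi, opp_opp]
            exact Or.inr (hp j)
          · rw [(hiff _ _).1 hq]
            exact Or.inl hi) (by simp) (Sum.inl v)
      simp at this
  choose u hu using h1
  exact ⟨p, u, hiff, hu⟩

theorem HairData.hairAt_iff {p : Fin h → Fin k × Bool} {u : Fin h → Fin N} (H : HairData G p u)
    (j : Fin h) (v : Fin N) : HairAt G j v ↔ v = u j := by
  constructor
  · rintro ⟨e, b, h1, h2⟩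
    have h3 := (H.eq_inr_iff _ _).1 h1
    have h4 := H.opp_eq j
    rw [← h3] at h4
    exact Sum.inl_injective (h2.symm.trans h4)
  · rintro rfl
    exact ⟨(p j).1, (p j).2, (H.eq_inr_iff _ _).2 rfl, H.opp_eq j⟩

end Basic

/-! ### The graph spaces -/

section Spaces

variable {K : Type*} [Field K] {n : ℤ} {N h k : ℕ}

theorem cls_of_not_isHairy {G : LabelledGraph N h k} (hG : ¬ IsHairy G) : cls K n G = 0 :=
  dif_neg hG

theorem liftGraphs_cls {M : Type*} [AddCommGroup M] [Module K M]
    (f : LabelledGraph N h k → M)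
    (hf : ∀ σ ρ τ φ (G G' : LabelledGraph N h k), IsRelabelling σ ρ τ φ G G' →
      f G' = (relabelSign n σ ρ τ φ : K) • f G) {G : LabelledGraph N h k} (hG : IsHairy G) :
    liftGraphs f hf (cls K n G) = f G := by
  rw [cls, dif_pos hG, liftGraphs, Submodule.mkQ_apply, Submodule.liftQ_apply]
  simp

theorem eq_zero_of_cls {M : Type*} [AddCommGroup M] [Module K M] (f : GraphSpace K n N h k →ₗ[K] M)
    (hf : ∀ G : LabelledGraph N h k, IsHairy G → f (cls K n G) = 0) : f = 0 := by
  refine Submodule.linearMap_qext _ (Finsupp.lhom_ext' fun G => LinearMap.ext_ring ?_)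
  have := hf G.1 G.2
  rw [cls, dif_pos G.2] at this
  simpa using this

/-- The two edges between which the labels are exchanged run between the same positions, but in
opposite directions relative to each other, so that the sign is `-1` for every `n`. -/
theorem cls_swap_edges {G G' : LabelledGraph N h (k + 1)} (r : Fin k × Bool)
    (h1 : G' (oldHalf k r) = G (0, false)) (h2 : G' (oldHalf k (opp r)) = G (0, true))
    (h3 : G' (0, true) = G (oldHalf k r)) (h4 : G' (0, false) = G (oldHalf k (opp r)))
    (h5 : ∀ q, q ≠ r → q ≠ opp r → G' (oldHalf k q) = G (oldHalf k q)) :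
    cls K n G' = - cls K n G := by
  classical
  obtain ⟨f, b⟩ := r
  -- The flips `b` and `!b` reverse exactly one of the two edges: the sign is that of the
  -- transposition for even `n` and that of the reversal for odd `n`.
  have H : IsRelabelling 1 1 (Equiv.swap 0 f.succ)
      (fun e => if e = 0 then b else if e = f.succ then !b else false) G G' := by
    intro e c
    have hid : ∀ a : Fin N ⊕ Fin h, Sum.map (1 : Equiv.Perm (Fin N)) (1 : Equiv.Perm (Fin h)) a = a := by
      rintro (a | a) <;> rfl
    rw [hid]
    refine Fin.cases ?_ (fun e => ?_) e
    · cases b <;> cases c <;> simp_all [oldHalf_apply, opp]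
    · by_cases he : e = f
      · subst he
        cases b <;> cases c <;> simp_all [oldHalf_apply, opp]
      · have h6 := h5 (e, c) (by simp [he]) (by simp [opp, he])
        have h7 : e.succ ≠ f.succ := by simpa using he
        simpa [h7, he, Equiv.swap_apply_of_ne_of_ne, oldHalf_apply] using h6
  rw [cls_relabel K n H]
  have hprod : (∏ e : Fin (k + 1), if (if e = 0 then b else if e = f.succ then !b else false) = true
      then (-1 : ℤ) else 1) = -1 := by
    rw [Fin.prod_univ_succ]
    cases b
    · simp [Fin.succ_ne_zero, Finset.prod_ite_eq']
    · simp [Fin.succ_ne_zero]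
  have : relabelSign n (1 : Equiv.Perm (Fin N)) (1 : Equiv.Perm (Fin h)) (Equiv.swap 0 f.succ)
      (fun e => if e = 0 then b else if e = f.succ then !b else false) = -1 := by
    rw [relabelSign, hprod]
    have : (0 : Fin (k + 1)) ≠ f.succ := (Fin.succ_ne_zero f).symm
    simp [Equiv.Perm.sign_swap this]
  rw [this]
  simp

end Spaces

/-! ### The square of the hair reconnection -/

section Reconnect

variable {K : Type*} [Field K] {n : ℤ} {N h k : ℕ}

/-- The effect of a reconnection on the vertices. -/
def reconnectVertex (j : Fin (h + 1)) (v : Fin N) : Fin N ⊕ Fin (h + 1) → Fin N ⊕ Fin h :=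
  Sum.elim Sum.inl
    (Fin.insertNth (α := fun _ => Fin N ⊕ Fin h) j (Sum.inl v) (Sum.inr : Fin h → Fin N ⊕ Fin h))

theorem reconnect_apply (G : LabelledGraph N (h + 1) k) (j : Fin (h + 1)) (v : Fin N)
    (p : Fin k × Bool) : reconnect G j v p = reconnectVertex j v (G p) := rfl

@[simp] theorem reconnectVertex_inl (j : Fin (h + 1)) (v a : Fin N) :
    reconnectVertex j v (Sum.inl a) = Sum.inl a := rfl

@[simp] theorem reconnectVertex_self (j : Fin (h + 1)) (v : Fin N) :
    reconnectVertex j v (Sum.inr j) = Sum.inl v := by simp [reconnectVertex]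

@[simp] theorem reconnectVertex_succAbove (j : Fin (h + 1)) (v : Fin N) (i : Fin h) :
    reconnectVertex j v (Sum.inr (j.succAbove i)) = Sum.inr i := by simp [reconnectVertex]

theorem reconnectVertex_eq_inr_iff (j : Fin (h + 1)) (v : Fin N) (i : Fin h)
    (a : Fin N ⊕ Fin (h + 1)) :
    reconnectVertex j v a = Sum.inr i ↔ a = Sum.inr (j.succAbove i) := by
  rcases a with a | a
  · simp
  · refine Fin.succAboveCases j ?_ (fun l => ?_) a
    · simp [(Fin.succAbove_ne j i).symm]
    · simp

theorem reconnectVertex_eq_inl_iff (j : Fin (h + 1)) (v x : Fin N) (a : Fin N ⊕ Fin (h + 1)) :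
    reconnectVertex j v a = Sum.inl x ↔ a = Sum.inl x ∨ a = Sum.inr j ∧ v = x := by
  rcases a with a | a
  · simp
  · refine Fin.succAboveCases j ?_ (fun l => ?_) a
    · simp
    · simp [Fin.succAbove_ne]

/-- Valences of internal vertices can only grow, and identifying `j` with `v` preserves
connectedness. The second hair is needed so that one is left. -/
theorem IsHairy.reconnect {G : LabelledGraph N (h + 2) k} (hG : IsHairy G) (j : Fin (h + 2))
    (v : Fin N) : IsHairy (reconnect G j v) where
  one_le_hairs := by omega
  connected := by
    refine connected_of_map hG.connected (reconnectVertex j v)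
      (fun p => reachable_opp (HairyGraph.reconnect G j v) p) fun w => ?_
    rcases w with a | i
    · exact ⟨Sum.inl a, by rw [reconnectVertex_inl]⟩
    · exact ⟨Sum.inr (j.succAbove i), by rw [reconnectVertex_succAbove]⟩
  univalent i := by
    simpa only [reconnect_apply, reconnectVertex_eq_inr_iff] using hG.univalent (j.succAbove i)
  trivalent x := by
    refine (hG.trivalent x).trans (Finset.card_le_card fun p hp => ?_)
    rw [Finset.mem_filter] at hp ⊢
    exact ⟨hp.1, by rw [reconnect_apply, hp.2, reconnectVertex_inl]⟩

theorem HairData.reconnect {G : LabelledGraph N (h + 1) k} {p : Fin (h + 1) → Fin k × Bool}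
    {u : Fin (h + 1) → Fin N} (H : HairData G p u) (j : Fin (h + 1)) (v : Fin N) :
    HairData (reconnect G j v) (p ∘ j.succAbove) (u ∘ j.succAbove) where
  eq_inr_iff q i := by
    rw [reconnect_apply, reconnectVertex_eq_inr_iff]
    exact H.eq_inr_iff q _
  opp_eq i := by
    rw [reconnect_apply, Function.comp_apply, H.opp_eq]
    rfl

open Classical in
theorem reconnectSum_eq {G : LabelledGraph N (h + 1) k} {p : Fin (h + 1) → Fin k × Bool}
    {u : Fin (h + 1) → Fin N} (H : HairData G p u) :
    reconnectSum K n G = ∑ j, ∑ v ∈ Finset.univ.filter (· ≠ u j),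
      (reconnectSign n N k j : K) • cls K n (reconnect G j v) := by
  simp only [reconnectSum, H.hairAt_iff, ne_eq]

theorem Δgraph_cls {G : LabelledGraph N (h + 1) k} (hG : IsHairy G) :
    HGC.Δgraph K n N h k (cls K n G) = reconnectSum K n G :=
  liftGraphs_cls _ _ hG

theorem reconnectSum_of_isEmpty [IsEmpty (Fin N)] (G : LabelledGraph N (h + 1) k) :
    reconnectSum K n G = 0 := by
  simp [reconnectSum]

/-- The pair `(j, i)` stands for the hair `j` followed by the hair `j.succAbove i`; the pair
`(j.succAbove i, i.predAbove j)` stands for the same two hairs in the other order. -/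
theorem reconnect_comm (G : LabelledGraph N (h + 2) k) (j : Fin (h + 2)) (i : Fin (h + 1))
    (v w : Fin N) :
    reconnect (reconnect G (j.succAbove i) w) (i.predAbove j) v =
      reconnect (reconnect G j v) i w := by
  funext p
  simp only [reconnect_apply]
  rcases G p with a | a
  · simp
  · refine Fin.succAboveCases j ?_ (fun l => ?_) a
    · have h1 : reconnectVertex (j.succAbove i) w (Sum.inr j : Fin N ⊕ Fin (h + 2)) =
          Sum.inr (i.predAbove j) := by
        rw [reconnectVertex_eq_inr_iff, Fin.succAbove_succAbove_predAbove]
      rw [h1]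
      simp
    · refine Fin.succAboveCases i ?_ (fun m => ?_) l
      · simp
      · rw [reconnectVertex_succAbove, reconnectVertex_succAbove,
          ← Fin.succAbove_succAbove_succAbove_predAbove, reconnectVertex_succAbove,
          reconnectVertex_succAbove]

/-- Removing the hair end in front first shifts the position of the other one by one, which gives
the minus sign. The part of the sign that comes from vertices or edges is the same on both sides. -/
theorem reconnectSign_mul_comm (n : ℤ) (N k : ℕ) (j : Fin (h + 2)) (i : Fin (h + 1)) :
    reconnectSign n N k (j.succAbove i) * reconnectSign n N k (i.predAbove j) =
      - (reconnectSign n N k j * reconnectSign n N k i) := by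
  have key : (-1 : ℤ) ^ (j.succAbove i : ℕ) * (-1) ^ (i.predAbove j : ℕ) =
      - ((-1) ^ (j : ℕ) * (-1) ^ (i : ℕ)) := by
    rcases lt_or_ge i.castSucc j with hij | hij
    · obtain ⟨m, rfl⟩ := Fin.exists_succ_eq.2 (Fin.ne_zero_of_lt hij)
      rw [Fin.succAbove_of_castSucc_lt _ _ hij, Fin.predAbove_of_castSucc_lt _ _ hij]
      simp [pow_succ, mul_comm]
    · rw [Fin.succAbove_of_le_castSucc _ _ hij, Fin.predAbove_of_le_castSucc _ _ hij]
      simp [pow_succ, mul_comm]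
  simp only [reconnectSign, pow_add]
  linear_combination ((-1) ^ (if Even n then k else N) * (-1) ^ (if Even n then k else N)) * key

theorem Δgraph_comp_Δgraph (K : Type*) [Field K] (n : ℤ) (N h k : ℕ) :
    HGC.Δgraph K n N (h + 1) k ∘ₗ HGC.Δgraph K n N (h + 2) k = 0 := by
  classical
  refine eq_zero_of_cls _ fun G hG => ?_
  rw [LinearMap.comp_apply, Δgraph_cls hG]
  rcases isEmpty_or_nonempty (Fin N) with hN | ⟨⟨v0⟩⟩
  · rw [reconnectSum_of_isEmpty, map_zero]
  obtain ⟨p, u, H⟩ := hG.exists_hairData v0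
  -- Reconnecting `j` does not move the origins of the other hairs, so the conditions on `v` and `w`
  -- do not depend on the order.
  have h1 : ∀ (j : Fin (h + 3)) (v : Fin N),
      HGC.Δgraph K n N (h + 1) k (cls K n (reconnect G j v)) = ∑ i,
        ∑ w ∈ Finset.univ.filter (· ≠ u (j.succAbove i)),
        (reconnectSign n N k i : K) • cls K n (reconnect (reconnect G j v) i w) := fun j v => by
    rw [Δgraph_cls (hG.reconnect j v), reconnectSum_eq (H.reconnect j v)]
    rfl
  simp only [reconnectSum_eq H, map_sum, map_smul, h1]
  have h2 : (∑ j : Fin (h + 3), ∑ v ∈ Finset.univ.filter (· ≠ u j),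
      (reconnectSign n N k j : K) • ∑ i : Fin (h + 2),
        ∑ w ∈ Finset.univ.filter (· ≠ u (j.succAbove i)),
        (reconnectSign n N k i : K) • cls K n (reconnect (reconnect G j v) i w)) =
      ∑ x : Fin (h + 3) × Fin (h + 2), ∑ v ∈ Finset.univ.filter (· ≠ u x.1),
        ∑ w ∈ Finset.univ.filter (· ≠ u (x.1.succAbove x.2)),
        ((reconnectSign n N k x.1 * reconnectSign n N k x.2 : ℤ) : K) •
          cls K n (reconnect (reconnect G x.1 v) x.2 w) := by
    rw [Fintype.sum_prod_type]
    refine Finset.sum_congr rfl fun j _ => ?_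
    rw [Finset.sum_comm (s := Finset.univ) (t := Finset.univ.filter (· ≠ u j))]
    refine Finset.sum_congr rfl fun v _ => ?_
    simp only [Finset.smul_sum, smul_smul, Int.cast_mul]
  rw [h2]
  refine Finset.sum_involution (fun x _ => (x.1.succAbove x.2, x.2.predAbove x.1)) ?_ ?_ ?_ ?_
  · rintro ⟨j, i⟩ -
    dsimp only
    rw [Finset.sum_comm (s := Finset.univ.filter (· ≠ u (j.succAbove i)))]
    rw [Fin.succAbove_succAbove_predAbove, ← Finset.sum_add_distrib]
    refine Finset.sum_eq_zero fun v _ => ?_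
    rw [← Finset.sum_add_distrib]
    refine Finset.sum_eq_zero fun w _ => ?_
    rw [reconnect_comm, reconnectSign_mul_comm, Int.cast_neg, neg_smul, add_neg_cancel]
  · rintro ⟨j, i⟩ - - hc
    exact Fin.succAbove_ne j i (congrArg Prod.fst hc)
  · intro x _
    exact Finset.mem_univ _
  · rintro ⟨j, i⟩ -
    simp [Fin.succAbove_succAbove_predAbove, Fin.predAbove_predAbove_succAbove]

end Reconnect

/-! ### Splitting a vertex -/

section Split

variable {K : Type*} [Field K] {n : ℤ} {N h k : ℕ}

@[simp] theorem split_zero_false (G : LabelledGraph N h k) (x : Fin N)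
    (S : Finset (Fin k × Bool)) : split G x S (0, false) = Sum.inl x.succ := rfl

@[simp] theorem split_zero_true (G : LabelledGraph N h k) (x : Fin N)
    (S : Finset (Fin k × Bool)) : split G x S (0, true) = Sum.inl 0 := rfl

theorem split_oldHalf (G : LabelledGraph N h k) (x : Fin N) (S : Finset (Fin k × Bool))
    (p : Fin k × Bool) :
    split G x S (oldHalf k p) = if p ∈ S then Sum.inl 0 else Sum.map Fin.succ id (G p) := rfl

theorem halfEdgesAt_split_zero (G : LabelledGraph N h k) (x : Fin N)
    (S : Finset (Fin k × Bool)) :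
    halfEdgesAt (split G x S) 0 = insert (0, true) (S.map (oldHalf k)) := by
  ext p
  rw [Finset.mem_filter]
  refine halfEdge_cases (fun b => ?_) (fun p => ?_) p
  · cases b <;> simp [Fin.succ_ne_zero, oldHalf_ne_zero]
  · by_cases hp : p ∈ S
    · simp [split_oldHalf, hp]
    · rcases hq : G p with a | a <;> simp [split_oldHalf, hp, hq, Fin.succ_ne_zero, oldHalf_ne_zero]

theorem halfEdgesAt_split_self (G : LabelledGraph N h k) (x : Fin N)
    (S : Finset (Fin k × Bool)) :
    halfEdgesAt (split G x S) x.succ =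
      insert (0, false) ((halfEdgesAt G x \ S).map (oldHalf k)) := by
  ext p
  rw [Finset.mem_filter]
  refine halfEdge_cases (fun b => ?_) (fun p => ?_) p
  · cases b <;> simp [(Fin.succ_ne_zero _).symm, oldHalf_ne_zero]
  · by_cases hp : p ∈ S
    · simp [split_oldHalf, hp, (Fin.succ_ne_zero _).symm, oldHalf_ne_zero]
    · rcases hq : G p with a | a <;> simp [split_oldHalf, hp, hq, oldHalf_ne_zero]

theorem halfEdgesAt_split_of_ne {G : LabelledGraph N h k} {x z : Fin N}
    {S : Finset (Fin k × Bool)} (hS : S ⊆ halfEdgesAt G x) (hz : z ≠ x) :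
    halfEdgesAt (split G x S) z.succ = (halfEdgesAt G z).map (oldHalf k) := by
  ext p
  rw [Finset.mem_filter]
  refine halfEdge_cases (fun b => ?_) (fun p => ?_) p
  · cases b <;> simp [(Fin.succ_ne_zero _).symm, oldHalf_ne_zero, hz.symm]
  · by_cases hp : p ∈ S
    · have := (Finset.mem_filter.1 (hS hp)).2
      simp [split_oldHalf, hp, (Fin.succ_ne_zero _).symm, this, hz.symm]
    · rcases hq : G p with a | a <;> simp [split_oldHalf, hp, hq]

theorem split_eq_inr_iff {G : LabelledGraph N h k} {x : Fin N} {S : Finset (Fin k × Bool)}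
    (hS : S ⊆ halfEdgesAt G x) (j : Fin h) (q : Fin (k + 1) × Bool) :
    split G x S q = Sum.inr j ↔ ∃ p, G p = Sum.inr j ∧ q = oldHalf k p := by
  refine halfEdge_cases (fun b => ?_) (fun p => ?_) q
  · cases b <;> simp [(oldHalf_ne_zero _ _).symm]
  · by_cases hp : p ∈ S
    · have := (Finset.mem_filter.1 (hS hp)).2
      simp [split_oldHalf, hp, this]
    · rcases hq : G p with a | a <;> simp [split_oldHalf, hp, hq]

theorem existsUnique_split_eq_inr_iff {G : LabelledGraph N h k} {x : Fin N}
    {S : Finset (Fin k × Bool)} (hS : S ⊆ halfEdgesAt G x) (j : Fin h) :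
    (∃! q, split G x S q = Sum.inr j) ↔ ∃! p, G p = Sum.inr j := by
  constructor
  · rintro ⟨q, hq, hu⟩
    obtain ⟨p, hp, rfl⟩ := (split_eq_inr_iff hS j q).1 hq
    refine ⟨p, hp, fun p' hp' => (oldHalf k).injective (hu _ ?_)⟩
    exact (split_eq_inr_iff hS j _).2 ⟨p', hp', rfl⟩
  · rintro ⟨p, hp, hu⟩
    refine ⟨oldHalf k p, (split_eq_inr_iff hS j _).2 ⟨p, hp, rfl⟩, fun q hq => ?_⟩
    obtain ⟨p', hp', rfl⟩ := (split_eq_inr_iff hS j q).1 hq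
    rw [hu p' hp']

theorem card_halfEdgesAt_split_zero (G : LabelledGraph N h k) (x : Fin N)
    (S : Finset (Fin k × Bool)) : (halfEdgesAt (split G x S) 0).card = S.card + 1 := by
  rw [halfEdgesAt_split_zero, Finset.card_insert_of_notMem (zero_notMem_map_oldHalf _ _),
    Finset.card_map]

theorem card_halfEdgesAt_split_self (G : LabelledGraph N h k) (x : Fin N)
    (S : Finset (Fin k × Bool)) :
    (halfEdgesAt (split G x S) x.succ).card = (halfEdgesAt G x \ S).card + 1 := by
  rw [halfEdgesAt_split_self, Finset.card_insert_of_notMem (zero_notMem_map_oldHalf _ _),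
    Finset.card_map]

/-- The contraction of the new edge of a splitting of `x`. -/
def contractVertex (x : Fin N) : Fin (N + 1) ⊕ Fin h → Fin N ⊕ Fin h :=
  Sum.map (Fin.cases x id) id

theorem contractVertex_split {G : LabelledGraph N h k} {x : Fin N} {S : Finset (Fin k × Bool)}
    (hS : S ⊆ halfEdgesAt G x) (p : Fin k × Bool) :
    contractVertex x (split G x S (oldHalf k p)) = G p := by
  by_cases hp : p ∈ S
  · have := (Finset.mem_filter.1 (hS hp)).2
    simp [split_oldHalf, hp, this, contractVertex]
  · rcases hq : G p with a | a <;> simp [split_oldHalf, hp, hq, contractVertex]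

/-- Contracting the new edge joins valences `a, b ≥ 3` to `a + b - 2 ≥ 4`. -/
theorem isHairy_of_split {G : LabelledGraph N h k} {x : Fin N} {S : Finset (Fin k × Bool)}
    (hS : S ⊆ halfEdgesAt G x) (hG : IsHairy (split G x S)) : IsHairy G where
  one_le_hairs := hG.one_le_hairs
  connected := by
    refine connected_of_map hG.connected (contractVertex x) (fun p => ?_) fun w => ?_
    · refine halfEdge_cases (fun b => ?_) (fun p => ?_) p
      · have : contractVertex x (split G x S (0, b)) =
            contractVertex x (split G x S (opp (0, b))) := by
          cases b <;> simp [opp, contractVertex]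
        rw [this]
      · rw [opp_oldHalf, contractVertex_split hS, contractVertex_split hS]
        exact reachable_opp G p
    · refine ⟨Sum.map Fin.succ id w, ?_⟩
      rcases w with w | w <;> exact SimpleGraph.Reachable.refl _
  univalent j := (existsUnique_split_eq_inr_iff hS j).1 (hG.univalent j)
  trivalent v := by
    by_cases hv : v = x
    · subst hv
      have h1 : 3 ≤ (halfEdgesAt (split G v S) 0).card := hG.trivalent 0
      have h2 : 3 ≤ (halfEdgesAt (split G v S) v.succ).card := hG.trivalent v.succ
      rw [card_halfEdgesAt_split_zero] at h1
      rw [card_halfEdgesAt_split_self] at h2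
      have h3 := Finset.card_sdiff_add_card_eq_card hS
      change 3 ≤ (halfEdgesAt G v).card
      omega
    · have h1 : 3 ≤ (halfEdgesAt (split G x S) v.succ).card := hG.trivalent v.succ
      rwa [halfEdgesAt_split_of_ne hS hv, Finset.card_map] at h1

theorem IsHairy.split {G : LabelledGraph N h k} (hG : IsHairy G) {x : Fin N}
    {S : Finset (Fin k × Bool)} (hS : S ⊆ halfEdgesAt G x) (h1 : 2 ≤ S.card)
    (h2 : 2 ≤ (halfEdgesAt G x \ S).card) : IsHairy (split G x S) where
  one_le_hairs := hG.one_le_hairs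
  connected := by
    have h0 : (adjGraph (HairyGraph.split G x S)).Reachable (Sum.inl x.succ) (Sum.inl 0) :=
      reachable_opp (HairyGraph.split G x S) (0, false)
    have h3 : ∀ p, (adjGraph (HairyGraph.split G x S)).Reachable (Sum.map Fin.succ id (G p))
        (HairyGraph.split G x S (oldHalf k p)) := by
      intro p
      rw [split_oldHalf]
      split_ifs with hp
      · rw [(Finset.mem_filter.1 (hS hp)).2]
        exact h0
      · rfl
    refine connected_of_map hG.connected (Sum.map Fin.succ id) (fun p => ?_) fun w => ?_
    · exact ((h3 p).trans (reachable_opp _ (oldHalf k p))).trans (h3 (opp p)).symm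
    · rcases w with w | w
      · refine Fin.cases ⟨Sum.inl x, h0⟩ (fun w => ⟨Sum.inl w, ?_⟩) w
        rfl
      · exact ⟨Sum.inr w, by rfl⟩
  univalent j := (existsUnique_split_eq_inr_iff hS j).2 (hG.univalent j)
  trivalent v := by
    change 3 ≤ (halfEdgesAt (HairyGraph.split G x S) v).card
    refine Fin.cases ?_ (fun v => ?_) v
    · rw [card_halfEdgesAt_split_zero]
      omega
    · by_cases hv : v = x
      · subst hv
        rw [card_halfEdgesAt_split_self]
        omega
      · rw [halfEdgesAt_split_of_ne hS hv, Finset.card_map]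
        exact hG.trivalent v

/-- Hairiness of `G` is not required: a graph outside the complex has only splittings outside it.
Hence twofold splittings can be summed over all subsets, with no condition on the intermediate
graph. -/
theorem δgraph_cls (G : LabelledGraph N h k) :
    HGC.δgraph K n N h k (cls K n G) = splitSum K n G := by
  by_cases hG : IsHairy G
  · exact liftGraphs_cls _ _ hG
  · rw [cls_of_not_isHairy hG, map_zero, splitSum, Finset.sum_eq_zero, smul_zero]
    intro x _
    refine Finset.sum_eq_zero fun S hS => cls_of_not_isHairy fun hc => hG ?_
    exact isHairy_of_split (Finset.mem_powerset.1 hS) hc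

end Split

/-! ### The square of the splitting differential -/

section SplitSquare

variable {K : Type*} [Field K] {n : ℤ} {N h k : ℕ}

theorem sum_powerset_map {α β M : Type*} [AddCommMonoid M] (e : α ↪ β) (T : Finset α)
    (f : Finset β → M) :
    ∑ S ∈ (T.map e).powerset, f S = ∑ R ∈ T.powerset, f (R.map e) := by
  classical
  have : (T.map e).powerset = T.powerset.map (Finset.mapEmbedding e).toEmbedding := by
    ext S
    simp only [Finset.mem_powerset, Finset.mem_map, RelEmbedding.coe_toEmbedding,
      Finset.mapEmbedding_apply, Finset.subset_map_iff]
    exact ⟨fun ⟨u, h1, h2⟩ => ⟨u, h1, h2.symm⟩, fun ⟨u, h1, h2⟩ => ⟨u, h1, h2.symm⟩⟩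
  rw [this, Finset.sum_map]
  rfl

theorem sum_powerset_insert_oldHalf {M : Type*} [AddCommMonoid M] (b : Bool)
    (T : Finset (Fin k × Bool)) (f : Finset (Fin (k + 1) × Bool) → M) :
    ∑ S ∈ (insert (0, b) (T.map (oldHalf k))).powerset, f S =
      ∑ R ∈ T.powerset, f (R.map (oldHalf k)) +
        ∑ R ∈ T.powerset, f (insert (0, b) (R.map (oldHalf k))) := by
  rw [Finset.sum_powerset_insert (zero_notMem_map_oldHalf T b), sum_powerset_map, sum_powerset_map]

/-- For even `n` the two edges are odd, for odd `n` the two vertices are; no edge is reversed.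
Either way one transposition counts. -/
theorem cls_swap_splittings {G G' : LabelledGraph N h (k + 2)} {a b : Fin N} (hab : a ≠ b)
    (h1 : ∀ c, G' (oldHalf _ (0, c)) = Sum.map (Equiv.swap a b) id (G (0, c)))
    (h2 : ∀ c, G' (0, c) = Sum.map (Equiv.swap a b) id (G (oldHalf _ (0, c))))
    (h3 : ∀ p, G' (oldHalf _ (oldHalf k p)) =
      Sum.map (Equiv.swap a b) id (G (oldHalf _ (oldHalf k p)))) :
    cls K n G' = - cls K n G := by
  have H : IsRelabelling (Equiv.swap a b) 1 (Equiv.swap 0 1) (fun _ => false) G G' := by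
    intro e c
    rw [Bool.false_xor]
    refine Fin.cases ?_ (fun e => Fin.cases ?_ (fun e => ?_) e) e
    · rw [Equiv.swap_apply_left]
      exact h1 c
    · rw [Fin.succ_zero_eq_one, Equiv.swap_apply_right]
      exact h2 c
    · rw [Equiv.swap_apply_of_ne_of_ne (Fin.succ_ne_zero _) (by simp [Fin.ext_iff])]
      exact h3 (e, c)
  rw [cls_relabel K n H]
  have : relabelSign n (Equiv.swap a b) (1 : Equiv.Perm (Fin h)) (Equiv.swap 0 1)
      (fun _ : Fin (k + 2) => false) = -1 := by
    have h01 : (0 : Fin (k + 2)) ≠ 1 := by simp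
    simp [relabelSign, Equiv.Perm.sign_swap hab, Equiv.Perm.sign_swap h01]
  rw [this]
  simp

theorem map_swap_zero_one (a : Fin N ⊕ Fin h) :
    Sum.map (Equiv.swap (0 : Fin (N + 2)) 1) id (Sum.map Fin.succ id (Sum.map Fin.succ id a)) =
      Sum.map Fin.succ id (Sum.map Fin.succ id a) := by
  rcases a with a | a
  · simp only [Sum.map_inl]
    rw [Equiv.swap_apply_of_ne_of_ne (Fin.succ_ne_zero _) (by simp [Fin.ext_iff])]
  · rfl

theorem swap_zero_one_succ (a : Fin N) : Equiv.swap (0 : Fin (N + 2)) 1 a.succ.succ = a.succ.succ :=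
  Equiv.swap_apply_of_ne_of_ne (Fin.succ_ne_zero _) (by simp [Fin.ext_iff])

/-- Both new vertices are adjacent to `x`, one carrying `S` and the other `R`. -/
theorem cls_split_split_self_comm (G : LabelledGraph N h k) (x : Fin N)
    {S R : Finset (Fin k × Bool)} (hSR : Disjoint S R) :
    cls K n (split (split G x R) x.succ (S.map (oldHalf k))) =
      - cls K n (split (split G x S) x.succ (R.map (oldHalf k))) := by
  refine cls_swap_splittings (a := 0) (b := 1) (by simp) (fun c => ?_) (fun c => ?_) fun p => ?_
  · cases c <;> simp [split_oldHalf, oldHalf_ne_zero, swap_zero_one_succ]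
  · cases c <;> simp [split_oldHalf, oldHalf_ne_zero, swap_zero_one_succ]
  · by_cases hS : p ∈ S
    · have hR := Finset.disjoint_left.1 hSR hS
      simp [split_oldHalf, hS, hR]
    · by_cases hR : p ∈ R <;> simp [split_oldHalf, hS, hR, map_swap_zero_one, -Sum.map_map]

theorem cls_split_split_comm (G : LabelledGraph N h k) {x z : Fin N}
    {S R : Finset (Fin k × Bool)} (hSR : Disjoint S R) :
    cls K n (split (split G z R) x.succ (S.map (oldHalf k))) =
      - cls K n (split (split G x S) z.succ (R.map (oldHalf k))) := by
  refine cls_swap_splittings (a := 0) (b := 1) (by simp) (fun c => ?_) (fun c => ?_) fun p => ?_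
  · cases c <;> simp [split_oldHalf, oldHalf_ne_zero, swap_zero_one_succ]
  · cases c <;> simp [split_oldHalf, oldHalf_ne_zero, swap_zero_one_succ]
  · by_cases hS : p ∈ S
    · have hR := Finset.disjoint_left.1 hSR hS
      simp [split_oldHalf, hS, hR]
    · by_cases hR : p ∈ R <;> simp [split_oldHalf, hS, hR, map_swap_zero_one, -Sum.map_map]

/-- Both sides are the chain from `x` through a vertex carrying `R` to a vertex carrying `S`. On the
left the far vertex is split off the middle one; on the right the middle one is inserted next to
`x`. -/
theorem cls_split_split_chain (G : LabelledGraph N h k) (x : Fin N)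
    {S R : Finset (Fin k × Bool)} (hSR : Disjoint S R) :
    cls K n (split (split G x (S ∪ R)) 0 (S.map (oldHalf k))) =
      - cls K n (split (split G x S) x.succ (insert (0, false) (R.map (oldHalf k)))) := by
  refine cls_swap_splittings (a := 0) (b := 1) (by simp) (fun c => ?_) (fun c => ?_) fun p => ?_
  · cases c <;> simp [split_oldHalf, oldHalf_ne_zero, swap_zero_one_succ]
  · cases c <;> simp [split_oldHalf, oldHalf_ne_zero]
  · by_cases hS : p ∈ S
    · have hR := Finset.disjoint_left.1 hSR hS
      simp [split_oldHalf, hS, hR, oldHalf_ne_zero]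
    · by_cases hR : p ∈ R <;>
        simp [split_oldHalf, hS, hR, oldHalf_ne_zero, map_swap_zero_one, -Sum.map_map]

/-- Again a chain, whose middle vertex carries `R`, but now both new edges point to the middle.
Replacing `S` by its complement together with `R` exchanges the two ends of the chain, one of which
is `x`; for `R ⊆ S` this is a symmetry of the family. -/
theorem cls_split_split_reverse (G : LabelledGraph N h k) (x : Fin N)
    {S R : Finset (Fin k × Bool)} (hS : S ⊆ halfEdgesAt G x) :
    cls K n (split (split G x (halfEdgesAt G x \ S ∪ R)) 0
        (insert (0, true) (R.map (oldHalf k)))) =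
      - cls K n (split (split G x S) 0 (insert (0, true) (R.map (oldHalf k)))) := by
  have h1 : (1 : Fin (N + 2)) ≠ x.succ.succ := by simp [Fin.ext_iff]
  have h0 : Equiv.swap (1 : Fin (N + 2)) x.succ.succ 0 = 0 :=
    Equiv.swap_apply_of_ne_of_ne (by simp) (Fin.succ_ne_zero _).symm
  refine cls_swap_splittings (a := 1) (b := x.succ.succ) h1 (fun c => ?_) (fun c => ?_) fun p => ?_
  · cases c <;> simp [split_oldHalf, oldHalf_ne_zero, h0]
  · cases c <;> simp [split_oldHalf, oldHalf_ne_zero, h0]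
  · by_cases hpR : p ∈ R
    · simp [split_oldHalf, hpR, h0]
    · by_cases hpS : p ∈ S
      · have := (Finset.mem_filter.1 (hS hpS)).2
        simp [split_oldHalf, hpR, hpS, oldHalf_ne_zero, this]
      · by_cases hpx : G p = Sum.inl x
        · simp [split_oldHalf, hpR, hpS, oldHalf_ne_zero, hpx]
        · rcases hq : G p with a | a
          · rw [hq] at hpx
            have h2 : a.succ.succ ≠ x.succ.succ := by simpa using hpx
            have h3 : a.succ.succ ≠ (1 : Fin (N + 2)) := by simp [Fin.ext_iff]
            have h4 : a ≠ x := by simpa using hpx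
            simp [split_oldHalf, hpR, hpS, oldHalf_ne_zero, hq, h4,
              Equiv.swap_apply_of_ne_of_ne h3 h2]
          · simp [split_oldHalf, hpR, hpS, oldHalf_ne_zero, hq]

/-- The sum over all splittings of the graph that arises from `G` by splitting `x`. -/
theorem sum_split_split (G : LabelledGraph N h k) (x : Fin N) {S : Finset (Fin k × Bool)}
    (hS : S ⊆ halfEdgesAt G x) :
    ∑ y, ∑ R ∈ (halfEdgesAt (split G x S) y).powerset, cls K n (split (split G x S) y R) =
      ((∑ R ∈ S.powerset, cls K n (split (split G x S) 0 (R.map (oldHalf k)))) +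
        ∑ R ∈ S.powerset, cls K n (split (split G x S) 0
          (insert (0, true) (R.map (oldHalf k))))) +
      (((∑ R ∈ (halfEdgesAt G x \ S).powerset,
          cls K n (split (split G x S) x.succ (R.map (oldHalf k)))) +
        ∑ R ∈ (halfEdgesAt G x \ S).powerset, cls K n (split (split G x S) x.succ
          (insert (0, false) (R.map (oldHalf k))))) +
        ∑ z ∈ Finset.univ.erase x, ∑ R ∈ (halfEdgesAt G z).powerset,
          cls K n (split (split G x S) z.succ (R.map (oldHalf k)))) := by
  rw [Fin.sum_univ_succ, halfEdgesAt_split_zero, sum_powerset_insert_oldHalf,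
    ← Finset.add_sum_erase _ _ (Finset.mem_univ x), halfEdgesAt_split_self,
    sum_powerset_insert_oldHalf]
  congr 2
  refine Finset.sum_congr rfl fun z hz => ?_
  rw [halfEdgesAt_split_of_ne hS (Finset.ne_of_mem_erase hz), sum_powerset_map]

theorem eq_zero_of_eq_neg_self [CharZero K] {M : Type*} [AddCommGroup M] [Module K M] {a : M}
    (ha : a = - a) : a = 0 := by
  have h2 : (2 : K) • a = 0 := by
    rw [two_smul]
    nth_rewrite 2 [ha]
    exact add_neg_cancel a
  exact (smul_eq_zero.1 h2).resolve_left two_ne_zero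

theorem disjoint_halfEdgesAt (G : LabelledGraph N h k) {x z : Fin N} (hxz : z ≠ x)
    {S R : Finset (Fin k × Bool)} (hS : S ⊆ halfEdgesAt G x) (hR : R ⊆ halfEdgesAt G z) :
    Disjoint S R := by
  refine Finset.disjoint_left.2 fun p h1 h2 => hxz ?_
  have h3 := (Finset.mem_filter.1 (hS h1)).2
  have h4 := (Finset.mem_filter.1 (hR h2)).2
  exact Sum.inl_injective (h4.symm.trans h3)

/-- Of the five families in `sum_split_split`, three are antisymmetric under an involution of their
index set (`h1`, `h3`, `h4`) and the other two cancel each other (`h2`). As an antisymmetric sum is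
only shown to equal its own negative, `2` has to be invertible. -/
theorem sum_splittings_of_splittings [CharZero K] (G : LabelledGraph N h k) :
    ∑ x, ∑ S ∈ (halfEdgesAt G x).powerset, ∑ y, ∑ R ∈ (halfEdgesAt (split G x S) y).powerset,
      cls K n (split (split G x S) y R) = 0 := by
  have h1 : ∀ x, ∑ S ∈ (halfEdgesAt G x).powerset, ∑ R ∈ (halfEdgesAt G x \ S).powerset,
      cls K n (split (split G x S) x.succ (R.map (oldHalf k))) = 0 := by
    intro x
    refine eq_zero_of_eq_neg_self (K := K) ?_
    have hcomm : ∀ S R : Finset (Fin k × Bool), S ∈ (halfEdgesAt G x).powerset ∧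
        R ∈ (halfEdgesAt G x \ S).powerset ↔ S ∈ (halfEdgesAt G x \ R).powerset ∧
        R ∈ (halfEdgesAt G x).powerset := by
      intro S R
      simp only [Finset.mem_powerset, Finset.subset_sdiff]
      rw [disjoint_comm]
      tauto
    refine (Finset.sum_comm' hcomm).trans ?_
    rw [← Finset.sum_neg_distrib]
    refine Finset.sum_congr rfl fun R _ => ?_
    rw [← Finset.sum_neg_distrib]
    refine Finset.sum_congr rfl fun S hS => ?_
    rw [Finset.mem_powerset, Finset.subset_sdiff] at hS
    exact cls_split_split_self_comm G x hS.2.symm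
  have hpow : ∀ x, ∀ T S : Finset (Fin k × Bool), T ∈ (halfEdgesAt G x).powerset ∧
      S ∈ T.powerset ↔ T ∈ (halfEdgesAt G x).powerset.filter (S ⊆ ·) ∧
      S ∈ (halfEdgesAt G x).powerset := by
    intro x T S
    simp only [Finset.mem_powerset, Finset.mem_filter]
    exact ⟨fun hT => ⟨hT, hT.2.trans hT.1⟩, fun hT => hT.1⟩
  have h2 : ∀ x, (∑ S ∈ (halfEdgesAt G x).powerset, ∑ R ∈ S.powerset,
      cls K n (split (split G x S) 0 (R.map (oldHalf k)))) +
      ∑ S ∈ (halfEdgesAt G x).powerset, ∑ R ∈ (halfEdgesAt G x \ S).powerset,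
      cls K n (split (split G x S) x.succ (insert (0, false) (R.map (oldHalf k)))) = 0 := by
    intro x
    rw [add_eq_zero_iff_eq_neg, ← Finset.sum_neg_distrib]
    rw [Finset.sum_comm' (hpow x)]
    refine Finset.sum_congr rfl fun S hS => ?_
    rw [Finset.mem_powerset] at hS
    rw [← Finset.sum_neg_distrib]
    -- In the first family the set moved first is `T = S ∪ R`, in the second it is `S`; the set `R`
    -- stays on the middle vertex.
    refine Finset.sum_bij' (fun T _ => T \ S) (fun R _ => S ∪ R) ?_ ?_ ?_ ?_ ?_
    · intro T hT
      simp only [Finset.mem_powerset, Finset.mem_filter] at hT ⊢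
      exact Finset.sdiff_subset_sdiff hT.1 le_rfl
    · intro R hR
      simp only [Finset.mem_powerset, Finset.mem_filter, Finset.subset_sdiff] at hR ⊢
      exact ⟨Finset.union_subset hS hR.1, Finset.subset_union_left⟩
    · intro T hT
      exact Finset.union_sdiff_of_subset (Finset.mem_filter.1 hT).2
    · intro R hR
      simp only [Finset.mem_powerset, Finset.subset_sdiff] at hR
      rw [Finset.union_sdiff_cancel_left hR.2.symm]
    · intro T hT
      rw [← cls_split_split_chain G x Finset.disjoint_sdiff,
        Finset.union_sdiff_of_subset (Finset.mem_filter.1 hT).2]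
  have h3 : ∀ x, ∑ S ∈ (halfEdgesAt G x).powerset, ∑ R ∈ S.powerset,
      cls K n (split (split G x S) 0 (insert (0, true) (R.map (oldHalf k)))) = 0 := by
    intro x
    refine eq_zero_of_eq_neg_self (K := K) ?_
    rw [Finset.sum_comm' (hpow x), ← Finset.sum_neg_distrib]
    refine Finset.sum_congr rfl fun R hR => ?_
    rw [Finset.mem_powerset] at hR
    have hmem : ∀ S ∈ (halfEdgesAt G x).powerset.filter (R ⊆ ·),
        halfEdgesAt G x \ S ∪ R ∈ (halfEdgesAt G x).powerset.filter (R ⊆ ·) := by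
      intro S hS
      simp only [Finset.mem_powerset, Finset.mem_filter] at hS ⊢
      exact ⟨Finset.union_subset Finset.sdiff_subset hR, Finset.subset_union_right⟩
    have hinv : ∀ S ∈ (halfEdgesAt G x).powerset.filter (R ⊆ ·),
        halfEdgesAt G x \ (halfEdgesAt G x \ S ∪ R) ∪ R = S := by
      intro S hS
      rw [Finset.mem_filter, Finset.mem_powerset] at hS
      ext q
      have h5 := @hS.1 q
      have h6 := @hS.2 q
      simp only [Finset.mem_union, Finset.mem_sdiff]
      tauto
    rw [← Finset.sum_neg_distrib]
    refine Finset.sum_bij' (fun S _ => halfEdgesAt G x \ S ∪ R)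
      (fun S _ => halfEdgesAt G x \ S ∪ R) hmem hmem hinv hinv fun S hS => ?_
    rw [Finset.mem_filter, Finset.mem_powerset] at hS
    rw [cls_split_split_reverse G x hS.1, neg_neg]
  have h4 : ∑ x, ∑ S ∈ (halfEdgesAt G x).powerset, ∑ z ∈ Finset.univ.erase x,
      ∑ R ∈ (halfEdgesAt G z).powerset,
      cls K n (split (split G x S) z.succ (R.map (oldHalf k))) = 0 := by
    refine eq_zero_of_eq_neg_self (K := K) ?_
    have hcomm : ∀ x z : Fin N, x ∈ Finset.univ ∧ z ∈ Finset.univ.erase x ↔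
        x ∈ Finset.univ.erase z ∧ z ∈ Finset.univ := by
      intro x z
      simp [ne_comm]
    simp only [Finset.sum_comm (s := (halfEdgesAt G _).powerset) (t := Finset.univ.erase _)]
    refine (Finset.sum_comm' hcomm).trans ?_
    rw [← Finset.sum_neg_distrib]
    refine Finset.sum_congr rfl fun z _ => ?_
    rw [← Finset.sum_neg_distrib]
    refine Finset.sum_congr rfl fun x hx => ?_
    rw [Finset.sum_comm, ← Finset.sum_neg_distrib]
    refine Finset.sum_congr rfl fun R hR => ?_
    rw [← Finset.sum_neg_distrib]
    refine Finset.sum_congr rfl fun S hS => ?_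
    rw [Finset.mem_powerset] at hR hS
    exact cls_split_split_comm G
      (disjoint_halfEdgesAt G (Finset.ne_of_mem_erase hx) hR hS)
  calc _ = ∑ x, ∑ S ∈ (halfEdgesAt G x).powerset, _ :=
        Finset.sum_congr rfl fun x _ => Finset.sum_congr rfl fun S hS =>
          sum_split_split G x (Finset.mem_powerset.1 hS)
    _ = 0 := by
      simp only [Finset.sum_add_distrib, h1, h3, h4, zero_add, add_zero]
      rw [← Finset.sum_add_distrib]
      exact Finset.sum_eq_zero fun x _ => h2 x

theorem δgraph_comp_δgraph (K : Type*) [Field K] [CharZero K] (n : ℤ) (N h k : ℕ) :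
    HGC.δgraph K n (N + 1) h (k + 1) ∘ₗ HGC.δgraph K n N h k = 0 := by
  refine eq_zero_of_cls _ fun G _ => ?_
  rw [LinearMap.comp_apply, δgraph_cls, splitSum]
  simp only [map_smul, map_sum, δgraph_cls]
  simp only [splitSum, ← Finset.smul_sum]
  rw [sum_splittings_of_splittings, smul_zero, smul_zero]

end SplitSquare

/-! ### Attaching a hair to an edge -/

section Attach

variable {K : Type*} [Field K] {n : ℤ} {N h k : ℕ}

/-- The vertices of a graph, after a new internal vertex has been added and the hair `j` has been
reconnected to it. -/
def attachVertex (j : Fin (h + 1)) (a : Fin N ⊕ Fin (h + 1)) : Fin (N + 1) ⊕ Fin h :=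
  reconnectVertex j 0 (Sum.map Fin.succ id a)

@[simp] theorem attachVertex_inl (j : Fin (h + 1)) (a : Fin N) :
    attachVertex j (Sum.inl a) = Sum.inl a.succ := rfl

@[simp] theorem attachVertex_self (j : Fin (h + 1)) :
    attachVertex j (Sum.inr j : Fin N ⊕ Fin (h + 1)) = Sum.inl 0 := by simp [attachVertex]

@[simp] theorem attachVertex_succAbove (j : Fin (h + 1)) (i : Fin h) :
    attachVertex j (Sum.inr (j.succAbove i) : Fin N ⊕ Fin (h + 1)) = Sum.inr i := by
  simp [attachVertex]

/-- Attaching the hair `j` to the edge of the half-edge `r`: a new vertex is put on this edge, such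
that `r` is attached to it and the other part of the edge is the new edge, and the hair is
reconnected to the new vertex. -/
def attach (G : LabelledGraph N (h + 1) k) (j : Fin (h + 1)) (r : Fin k × Bool) :
    LabelledGraph (N + 1) h (k + 1) := fun q =>
  Fin.cases (if q.2 then Sum.inl 0 else attachVertex j (G r))
    (fun e => if (e, q.2) = r then Sum.inl 0 else attachVertex j (G (e, q.2))) q.1

@[simp] theorem attach_zero_false (G : LabelledGraph N (h + 1) k) (j : Fin (h + 1))
    (r : Fin k × Bool) : attach G j r (0, false) = attachVertex j (G r) := rfl

@[simp] theorem attach_zero_true (G : LabelledGraph N (h + 1) k) (j : Fin (h + 1))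
    (r : Fin k × Bool) : attach G j r (0, true) = Sum.inl 0 := rfl

theorem attach_oldHalf (G : LabelledGraph N (h + 1) k) (j : Fin (h + 1)) (r q : Fin k × Bool) :
    attach G j r (oldHalf k q) = if q = r then Sum.inl 0 else attachVertex j (G q) := rfl

/-- Splitting off a single half-edge only subdivides its edge; the reconnected hair makes the new
vertex trivalent. -/
theorem reconnect_split_singleton (G : LabelledGraph N (h + 1) k) (j : Fin (h + 1))
    {r : Fin k × Bool} {x : Fin N} (hr : G r = Sum.inl x) :
    reconnect (split G x {r}) j 0 = attach G j r := by
  funext q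
  rw [reconnect_apply]
  induction q using halfEdge_cases with
  | h0 b => cases b <;> simp [hr]
  | h1 q =>
    by_cases hq : q = r
    · simp [split_oldHalf, attach_oldHalf, hq]
    · simp [split_oldHalf, attach_oldHalf, hq, attachVertex]

/-- The same subdivided edge, with its two parts exchanged. -/
theorem cls_attach_opp (G : LabelledGraph N (h + 1) k) (j : Fin (h + 1)) (r : Fin k × Bool) :
    cls K n (attach G j (opp r)) = - cls K n (attach G j r) := by
  have hr : r ≠ opp r := (opp_ne r).symm
  refine cls_swap_edges r ?_ ?_ ?_ ?_ fun q h1 h2 => ?_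
  · simp [attach_oldHalf, hr]
  · simp [attach_oldHalf]
  · simp [attach_oldHalf]
  · simp [attach_oldHalf, hr.symm]
  · simp [attach_oldHalf, h1, h2]

theorem cls_map_hairs (G : LabelledGraph N h k) (ρ : Equiv.Perm (Fin h)) :
    cls K n (fun q => Sum.map id ρ (G q)) = ((Equiv.Perm.sign ρ : ℤ) : K) • cls K n G := by
  have H : IsRelabelling 1 ρ 1 (fun _ => false) G (fun q => Sum.map id ρ (G q)) := by
    intro e b
    rw [Bool.false_xor]
    rfl
  rw [cls_relabel K n H]
  simp [relabelSign]

theorem HairData.injective {G : LabelledGraph N h k} {p : Fin h → Fin k × Bool}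
    {u : Fin h → Fin N} (H : HairData G p u) : Function.Injective p := fun i j hij => by
  have h1 := (H.eq_inr_iff (p i) i).2 rfl
  have h2 := (H.eq_inr_iff (p i) j).2 hij
  exact Sum.inr_injective (h1.symm.trans h2)

theorem HairData.apply {G : LabelledGraph N h k} {p : Fin h → Fin k × Bool}
    {u : Fin h → Fin N} (H : HairData G p u) (j : Fin h) : G (p j) = Sum.inr j :=
  (H.eq_inr_iff _ _).2 rfl

theorem HairData.opp_ne {G : LabelledGraph N h k} {p : Fin h → Fin k × Bool}
    {u : Fin h → Fin N} (H : HairData G p u) (i j : Fin h) : opp (p i) ≠ p j := fun hij => by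
  have h1 := H.opp_eq i
  rw [hij, H.apply] at h1
  exact Sum.inr_ne_inl h1

/-- Attaching the hair `j` to the hair `i` and attaching the hair `i` to the hair `j` produce the
same graph, with opposite signs. -/
theorem cls_attach_hair_comm {G : LabelledGraph N (h + 1) k} {p : Fin (h + 1) → Fin k × Bool}
    {u : Fin (h + 1) → Fin N} (H : HairData G p u) {i j : Fin (h + 1)} (hij : i ≠ j) :
    (reconnectSign n N k i : K) • cls K n (attach G i (opp (p j))) =
      - ((reconnectSign n N k j : K) • cls K n (attach G j (opp (p i)))) := by
  -- The surviving end is that of `j` on one side and that of `i` on the other; `ρ` matches the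
  -- remaining labels, and `h2` relates its sign to the two reconnection signs.
  obtain ⟨ρ, h1, h2⟩ := exists_removePerm (Equiv.swap i j) j
  rw [Equiv.swap_apply_right] at h1 h2
  have hinl : ∀ a : Fin N, Sum.map id ρ (attachVertex j (Sum.inl a)) =
      attachVertex i (Sum.inl a) := fun a => rfl
  have hinr : ∀ l, Sum.map id ρ (attachVertex j (Sum.inr l : Fin N ⊕ Fin (h + 1))) =
      attachVertex i (Sum.inr (Equiv.swap i j l)) := by
    intro l
    refine Fin.succAboveCases j ?_ (fun a => ?_) l
    · simp
    · rw [attachVertex_succAbove, h1, attachVertex_succAbove]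
      rfl
  have hpp : ∀ a b, p a ≠ opp (p b) := fun a b => (H.opp_ne b a).symm
  -- In both graphs the new vertex meets the edges to `u i` and `u j` and one hair. Once the
  -- subdivided hair `j` is read from its outer half, only the new edge and the edge of hair `i` are
  -- exchanged.
  have key : cls K n (attach G i (p j)) =
      - cls K n (fun q => Sum.map id ρ (attach G j (opp (p i)) q)) := by
    refine cls_swap_edges (opp (p i)) ?_ ?_ ?_ ?_ fun q h3 h4 => ?_
    · simp [attach_oldHalf, H.opp_ne, H.opp_eq]
    · simp [attach_oldHalf, H.injective.ne hij, H.apply]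
    · simp [attach_oldHalf]
    · rw [opp_opp, attach_zero_false, attach_oldHalf, if_neg (hpp i i), H.apply, H.apply, hinr,
        Equiv.swap_apply_left]
    · rw [opp_opp] at h4
      rw [attach_oldHalf, attach_oldHalf, if_neg h3]
      split_ifs with hq
      · rw [hq, H.apply, attachVertex_self]
        rfl
      · rcases hl : G q with a | l
        · exact (hinl a).symm
        · rw [hinr, Equiv.swap_apply_of_ne_of_ne]
          · rintro rfl
            exact h4 ((H.eq_inr_iff _ _).1 hl)
          · rintro rfl
            exact hq ((H.eq_inr_iff _ _).1 hl)
  rw [cls_attach_opp, key, neg_neg, cls_map_hairs, smul_smul, ← Int.cast_mul, ← neg_smul,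
    ← Int.cast_neg]
  congr 2
  rw [Equiv.Perm.sign_swap hij] at h2
  simp only [reconnectSign, pow_add, mul_assoc, h2]
  simp

/-- Attaching a hair to an edge, in all possible ways that do not use only one hair. -/
theorem sum_attach {G : LabelledGraph N (h + 1) k} {p : Fin (h + 1) → Fin k × Bool}
    {u : Fin (h + 1) → Fin N} (H : HairData G p u) :
    ∑ x, ∑ r ∈ halfEdgesAt G x, ∑ j, (reconnectSign n N k j : K) •
      (if opp (p j) ≠ r then cls K n (reconnect (split G x {r}) j 0) else 0) = 0 := by
  classical
  have h1 : ∀ j, (∑ x, ∑ r ∈ halfEdgesAt G x,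
      if opp (p j) ≠ r then cls K n (reconnect (split G x {r}) j 0) else 0) =
      ∑ i ∈ Finset.univ.filter (j ≠ ·), cls K n (attach G j (opp (p i))) := by
    intro j
    have h2 : ∀ x, ∀ r ∈ halfEdgesAt G x,
        (if opp (p j) ≠ r then cls K n (reconnect (split G x {r}) j 0) else 0) =
        if opp (p j) ≠ r then cls K n (attach G j r) else 0 := by
      intro x r hr
      rw [reconnect_split_singleton G j (Finset.mem_filter.1 hr).2]
    rw [Finset.sum_congr rfl fun x _ => Finset.sum_congr rfl (h2 x)]
    rw [← Finset.sum_biUnion]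
    -- Edges between two internal vertices cancel under `opp`; only the inner halves of hairs
    -- remain.
    · rw [← Finset.sum_filter, ← Finset.sum_filter_add_sum_filter_not _
        (fun r => ∃ y, G (opp r) = Sum.inl y)]
      convert zero_add _ using 2
      · refine Finset.sum_involution (fun r _ => opp r) ?_ ?_ ?_ ?_
        · intro r _
          rw [cls_attach_opp, add_neg_cancel]
        · intro r _ _
          exact HairyGraph.opp_ne r
        · intro r hr
          simp only [Finset.mem_filter, Finset.mem_biUnion, Finset.mem_univ, true_and,
            opp_opp] at hr ⊢
          obtain ⟨⟨⟨x, hx⟩, -⟩, y, hy⟩ := hr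
          refine ⟨⟨⟨y, hy⟩, fun hc => ?_⟩, x, hx⟩
          have h3 := H.apply j
          rw [← opp_opp (p j), hc, opp_opp, hx] at h3
          exact Sum.inl_ne_inr h3
        · intro r _
          exact opp_opp r
      · refine Finset.sum_bij (fun i _ => opp (p i)) ?_ ?_ ?_ ?_
        · intro i hi
          have hij : j ≠ i := (Finset.mem_filter.1 hi).2
          simp only [Finset.mem_filter, Finset.mem_biUnion, Finset.mem_univ, true_and, opp_opp,
            H.apply]
          refine ⟨⟨⟨u i, H.opp_eq i⟩, fun hc => hij (H.injective ?_)⟩, by simp⟩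
          rw [← opp_opp (p j), hc, opp_opp]
        · intro a _ b _ hab
          refine H.injective ?_
          rw [← opp_opp (p a), hab, opp_opp]
        · intro r hr
          simp only [Finset.mem_filter, Finset.mem_biUnion, Finset.mem_univ, true_and] at hr
          rcases hi : G (opp r) with y | i
          · exact absurd ⟨y, hi⟩ hr.2
          · have h3 := (H.eq_inr_iff _ _).1 hi
            have h4 : opp (p i) = r := by rw [← h3, opp_opp]
            refine ⟨i, Finset.mem_filter.2 ⟨Finset.mem_univ _, ?_⟩, h4⟩
            rintro rfl
            exact hr.1.2 h4
        · intro i _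
          rfl
    · intro x _ y _ hxy
      exact disjoint_halfEdgesAt G hxy.symm le_rfl le_rfl
  have h2 : ∑ x, ∑ r ∈ halfEdgesAt G x, ∑ j, (reconnectSign n N k j : K) •
      (if opp (p j) ≠ r then cls K n (reconnect (split G x {r}) j 0) else 0) =
      ∑ j, (reconnectSign n N k j : K) • ∑ x, ∑ r ∈ halfEdgesAt G x,
        if opp (p j) ≠ r then cls K n (reconnect (split G x {r}) j 0) else 0 := by
    simp only [Finset.smul_sum]
    rw [Finset.sum_comm (s := Finset.univ (α := Fin (h + 1)))]
    refine Finset.sum_congr rfl fun x _ => ?_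
    rw [Finset.sum_comm]
  rw [h2]
  simp only [h1, Finset.smul_sum]
  rw [← Finset.sum_finset_product' (Finset.univ.filter fun a : Fin (h + 1) × Fin (h + 1) =>
    a.1 ≠ a.2) Finset.univ (fun j => Finset.univ.filter (j ≠ ·)) (by simp)
    (f := fun j i => (reconnectSign n N k j : K) • cls K n (attach G j (opp (p i))))]
  refine Finset.sum_involution (fun a _ => (a.2, a.1)) ?_ ?_ ?_ ?_
  · intro a ha
    rw [cls_attach_hair_comm H (Finset.mem_filter.1 ha).2, neg_add_cancel]
  · intro a ha _ hc
    exact (Finset.mem_filter.1 ha).2 (congrArg Prod.snd hc)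
  · intro a ha
    exact Finset.mem_filter.2 ⟨Finset.mem_univ _, (Finset.mem_filter.1 ha).2.symm⟩
  · intro a _
    rfl

end Attach

/-! ### Splitting a vertex and reconnecting a hair -/

section Anticommute

variable {K : Type*} [Field K] {n : ℤ} {N h k : ℕ}

theorem split_reconnect (G : LabelledGraph N (h + 1) k) (j : Fin (h + 1)) (v x : Fin N)
    (S : Finset (Fin k × Bool)) :
    split (reconnect G j v) x S = reconnect (split G x S) j v.succ := by
  funext q
  induction q using halfEdge_cases with
  | h0 b => cases b <;> simp [reconnect_apply]
  | h1 q =>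
    rw [split_oldHalf, reconnect_apply, reconnect_apply, split_oldHalf]
    split_ifs
    · rfl
    · rcases G q with a | a
      · rfl
      · refine Fin.succAboveCases j ?_ (fun l => ?_) a <;> simp

/-- Used with `v = x`: the reconnected half-edge is then one of those distributed by the splitting.
If it moves to the new vertex, the hair could have been reconnected there after the splitting. -/
theorem split_reconnect_insert {G : LabelledGraph N (h + 1) k} {p : Fin (h + 1) → Fin k × Bool}
    {u : Fin (h + 1) → Fin N} (H : HairData G p u) (j : Fin (h + 1)) (v x : Fin N)
    {S : Finset (Fin k × Bool)} (hS : p j ∉ S) :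
    split (reconnect G j v) x (insert (p j) S) = reconnect (split G x S) j 0 := by
  funext q
  induction q using halfEdge_cases with
  | h0 b => cases b <;> simp [reconnect_apply]
  | h1 q =>
    rw [split_oldHalf, reconnect_apply, reconnect_apply, split_oldHalf]
    by_cases hq : q = p j
    · subst hq
      simp [hS, H.apply]
    · by_cases hqS : q ∈ S
      · simp [hqS]
      · have hj : G q ≠ Sum.inr j := fun hc => hq ((H.eq_inr_iff _ _).1 hc)
        simp only [Finset.mem_insert, hq, hqS, or_self, if_false]
        rcases hG : G q with a | a
        · rfl
        · rw [hG] at hj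
          obtain ⟨l, rfl⟩ := Fin.exists_succAbove_eq (x := a) (y := j) (fun hc => hj (by rw [hc]))
          simp

theorem halfEdgesAt_reconnect_of_ne (G : LabelledGraph N (h + 1) k) (j : Fin (h + 1))
    {v x : Fin N} (hv : v ≠ x) : halfEdgesAt (reconnect G j v) x = halfEdgesAt G x := by
  ext q
  simp [reconnect_apply, reconnectVertex_eq_inl_iff, hv]

theorem halfEdgesAt_reconnect_self {G : LabelledGraph N (h + 1) k}
    {p : Fin (h + 1) → Fin k × Bool} {u : Fin (h + 1) → Fin N} (H : HairData G p u)
    (j : Fin (h + 1)) (x : Fin N) :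
    halfEdgesAt (reconnect G j x) x = insert (p j) (halfEdgesAt G x) := by
  ext q
  simp [reconnect_apply, reconnectVertex_eq_inl_iff, H.eq_inr_iff, or_comm]

theorem HairData.notMem_halfEdgesAt {G : LabelledGraph N h k} {p : Fin h → Fin k × Bool}
    {u : Fin h → Fin N} (H : HairData G p u) (j : Fin h) (x : Fin N) :
    p j ∉ halfEdgesAt G x := fun hc => by
  have h1 := (Finset.mem_filter.1 hc).2
  rw [H.apply] at h1
  exact Sum.inr_ne_inl h1

theorem HairData.opp_mem_halfEdgesAt {G : LabelledGraph N h k} {p : Fin h → Fin k × Bool}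
    {u : Fin h → Fin N} (H : HairData G p u) (j : Fin h) (x : Fin N) :
    opp (p j) ∈ halfEdgesAt G x ↔ u j = x := by
  simp [H.opp_eq]

theorem HairData.split {G : LabelledGraph N h k} {p : Fin h → Fin k × Bool}
    {u : Fin h → Fin N} (H : HairData G p u) {x : Fin N} {S : Finset (Fin k × Bool)}
    (hS : S ⊆ halfEdgesAt G x) :
    HairData (split G x S) (fun j => oldHalf k (p j))
      (fun j => if opp (p j) ∈ S then 0 else (u j).succ) where
  eq_inr_iff q j := by
    rw [split_eq_inr_iff hS]
    simp [H.eq_inr_iff]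
  opp_eq j := by
    rw [opp_oldHalf, split_oldHalf, H.opp_eq]
    split_ifs <;> rfl

/-- If the vertex of a hair is split and the hair is reconnected to the other one of the two
vertices, then a double edge arises; these terms cancel. -/
theorem sum_reconnect_split_of_vertex {G : LabelledGraph N (h + 1) k}
    {p : Fin (h + 1) → Fin k × Bool} {u : Fin (h + 1) → Fin N} (H : HairData G p u)
    (j : Fin (h + 1)) :
    ∑ S ∈ (halfEdgesAt G (u j)).powerset, cls K n (reconnect (split G (u j) S) j
      (if opp (p j) ∈ S then (u j).succ else 0)) = 0 := by
  have hq : opp (p j) ∈ halfEdgesAt G (u j) := (H.opp_mem_halfEdgesAt j _).2 rfl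
  -- Pair `S` with `insert (opp (p j)) S`: the reconnected hair runs parallel to the new edge, and
  -- the two terms differ by exchanging these edges.
  rw [← Finset.insert_erase hq, Finset.sum_powerset_insert (Finset.notMem_erase _ _),
    ← Finset.sum_add_distrib]
  refine Finset.sum_eq_zero fun S hS => ?_
  rw [Finset.mem_powerset] at hS
  have hqS : opp (p j) ∉ S := fun hc => Finset.notMem_erase _ _ (hS hc)
  have hpS : p j ∉ S := fun hc =>
    H.notMem_halfEdgesAt j (u j) (Finset.mem_of_mem_erase (hS hc))
  rw [if_neg hqS, if_pos (Finset.mem_insert_self _ _), add_eq_zero_iff_eq_neg]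
  have hpq : p j ≠ opp (p j) := (H.opp_ne j j).symm
  refine cls_swap_edges (opp (p j)) ?_ ?_ ?_ ?_ fun q h1 h2 => ?_
  · simp [reconnect_apply, split_oldHalf, hqS, H.opp_eq]
  · simp [reconnect_apply, split_oldHalf, hpS, H.apply]
  · simp [reconnect_apply, split_oldHalf]
  · simp [reconnect_apply, split_oldHalf, hpS, hpq, H.apply]
  · rw [opp_opp] at h2
    have h3 : G q ≠ Sum.inr j := fun hc => h2 ((H.eq_inr_iff _ _).1 hc)
    simp only [reconnect_apply, split_oldHalf, Finset.mem_insert, h1, false_or]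
    split_ifs
    · rfl
    · rcases hG : G q with a | a
      · rfl
      · rw [hG] at h3
        obtain ⟨l, rfl⟩ := Fin.exists_succAbove_eq (x := a) (y := j) (fun hc => h3 (by rw [hc]))
        simp

/-- The sum over all ways of reconnecting the hair `j` after the splitting of `x` that is given by
`S`. -/
def reconnectSplitSum (K : Type*) [Field K] (n : ℤ) (G : LabelledGraph N (h + 1) k)
    (p : Fin (h + 1) → Fin k × Bool) (u : Fin (h + 1) → Fin N) (j : Fin (h + 1)) (x : Fin N)
    (S : Finset (Fin k × Bool)) : GraphSpace K n (N + 1) h (k + 1) :=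
  ∑ w ∈ Finset.univ.filter (· ≠ if opp (p j) ∈ S then 0 else (u j).succ),
    cls K n (reconnect (split G x S) j w)

theorem reconnectSplitSum_eq (G : LabelledGraph N (h + 1) k)
    (p : Fin (h + 1) → Fin k × Bool) (u : Fin (h + 1) → Fin N) (j : Fin (h + 1)) (x : Fin N)
    (S : Finset (Fin k × Bool)) :
    reconnectSplitSum K n G p u j x S =
      (∑ v ∈ Finset.univ.filter (· ≠ u j), cls K n (reconnect (split G x S) j v.succ)) +
        cls K n (reconnect (split G x S) j (if opp (p j) ∈ S then (u j).succ else 0)) := by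
  rw [reconnectSplitSum, Finset.sum_filter, Finset.sum_filter, Fin.sum_univ_succ]
  by_cases hS : opp (p j) ∈ S
  · simp only [hS, if_true, ne_eq, not_true, if_false, zero_add, Fin.succ_ne_zero, not_false_iff]
    rw [← Finset.add_sum_erase _ _ (Finset.mem_univ (u j)),
      ← Finset.add_sum_erase _ (fun v => if ¬ v = u j then _ else _) (Finset.mem_univ (u j)),
      if_neg (not_not.2 rfl), zero_add]
    refine (add_comm _ _).trans (congrArg₂ _ (Finset.sum_congr rfl fun v hv => ?_) rfl)
    rw [if_pos (Finset.ne_of_mem_erase hv)]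
  · simp only [hS, ne_eq, (Fin.succ_ne_zero _).symm, not_false_iff, if_true, if_false,
      Fin.succ_inj]
    exact add_comm _ _

/-- The summand for `S` includes splittings outside the complex. A target `v = x` becomes either
half of the split vertex. For `x = u j` the right-hand side has additional terms, from one half to
the other, and these cancel. -/
theorem sum_split_reconnect {G : LabelledGraph N (h + 1) k}
    {p : Fin (h + 1) → Fin k × Bool} {u : Fin (h + 1) → Fin N} (H : HairData G p u)
    (j : Fin (h + 1)) (x : Fin N) :
    ∑ v ∈ Finset.univ.filter (· ≠ u j), ∑ S ∈ (halfEdgesAt (reconnect G j v) x).powerset,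
      cls K n (split (reconnect G j v) x S) =
    ∑ S ∈ (halfEdgesAt G x).powerset, reconnectSplitSum K n G p u j x S := by
  have h1 : ∀ v, ∑ S ∈ (halfEdgesAt (reconnect G j v) x).powerset,
      cls K n (split (reconnect G j v) x S) =
      (∑ S ∈ (halfEdgesAt G x).powerset, cls K n (reconnect (split G x S) j v.succ)) +
        if v = x then ∑ S ∈ (halfEdgesAt G x).powerset, cls K n (reconnect (split G x S) j 0)
        else 0 := by
    intro v
    split_ifs with hv
    · subst hv
      rw [halfEdgesAt_reconnect_self H, Finset.sum_powerset_insert (H.notMem_halfEdgesAt j v)]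
      refine congrArg₂ _ (Finset.sum_congr rfl fun S _ => by rw [split_reconnect])
        (Finset.sum_congr rfl fun S hS => ?_)
      rw [split_reconnect_insert H]
      exact fun hc => H.notMem_halfEdgesAt j v (Finset.mem_powerset.1 hS hc)
    · rw [halfEdgesAt_reconnect_of_ne G j hv, add_zero]
      simp only [split_reconnect]
  simp only [h1, reconnectSplitSum_eq, Finset.sum_add_distrib]
  refine congrArg₂ _ Finset.sum_comm ?_
  rw [Finset.sum_ite_eq']
  by_cases hx : x = u j
  · subst hx
    rw [if_neg (by simp), sum_reconnect_split_of_vertex H]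
  · rw [if_pos (by simpa using hx)]
    refine Finset.sum_congr rfl fun S hS => ?_
    rw [if_neg]
    intro hc
    exact hx ((H.opp_mem_halfEdgesAt j x).1 (Finset.mem_powerset.1 hS hc)).symm

/-! ### Correction terms from splittings with a vertex of low valence -/

/-- Exchanging the halves of `x` also reverses the new edge. For odd `n` the two signs cancel, for
even `n` there are none. -/
theorem cls_reconnect_split_compl {G : LabelledGraph N (h + 1) k} (j : Fin (h + 1)) (x : Fin N)
    {S : Finset (Fin k × Bool)} (hS : S ⊆ halfEdgesAt G x) :
    cls K n (reconnect (split G x (halfEdgesAt G x \ S)) j 0) =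
      cls K n (reconnect (split G x S) j x.succ) := by
  have h0 : (0 : Fin (N + 1)) ≠ x.succ := (Fin.succ_ne_zero x).symm
  have hmap : ∀ a : Fin N ⊕ Fin (h + 1), a ≠ Sum.inl x →
      reconnectVertex j 0 (Sum.map Fin.succ id a) = Sum.map (Equiv.swap 0 x.succ)
        (1 : Equiv.Perm (Fin h)) (reconnectVertex j x.succ (Sum.map Fin.succ id a)) := by
    rintro (a | a) ha
    · have hax : a.succ ≠ x.succ := by simpa using ha
      simp [Equiv.swap_apply_of_ne_of_ne (Fin.succ_ne_zero a) hax]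
    · refine Fin.succAboveCases j ?_ (fun l => ?_) a <;> simp
  have H : IsRelabelling (Equiv.swap 0 x.succ) 1 1 (Fin.cons true fun _ => false)
      (reconnect (split G x S) j x.succ) (reconnect (split G x (halfEdgesAt G x \ S)) j 0) := by
    intro e b
    refine Fin.cases ?_ (fun e => ?_) e
    · cases b <;> simp [reconnect_apply]
    · simp only [Equiv.Perm.coe_one, id_eq, Fin.cons_succ, Bool.false_xor]
      have := oldHalf_apply (e, b)
      dsimp only at this
      rw [← this, reconnect_apply, reconnect_apply, split_oldHalf, split_oldHalf]
      by_cases h1 : (e, b) ∈ S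
      · have h2 := (Finset.mem_filter.1 (hS h1)).2
        simp [h1, h2]
      · by_cases h2 : G (e, b) = Sum.inl x
        · simp [h1, h2]
        · rw [if_neg (by simp [h2]), if_neg h1]
          exact hmap _ h2
  rw [cls_relabel K n H]
  have : relabelSign n (Equiv.swap 0 x.succ) (1 : Equiv.Perm (Fin h)) (1 : Equiv.Perm (Fin (k + 1)))
      (Fin.cons true fun _ => false) = 1 := by
    simp [relabelSign, Equiv.Perm.sign_swap h0, Fin.prod_univ_succ]
  rw [this]
  simp

/-- If the splitting produces a vertex of valence two, then a hair has to be reconnected to this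
vertex. -/
theorem cls_reconnect_split_of_not_isHairy {G : LabelledGraph N (h + 1) k} (hG : IsHairy G)
    {p : Fin (h + 1) → Fin k × Bool} {u : Fin (h + 1) → Fin N} (H : HairData G p u)
    (j : Fin (h + 1)) {x : Fin N} {S : Finset (Fin k × Bool)} (hS : S ⊆ halfEdgesAt G x)
    (hbad : ¬ IsHairy (split G x S)) (w : Fin (N + 1)) :
    cls K n (reconnect (split G x S) j w) =
      (if w = 0 then if S.card = 1 then cls K n (reconnect (split G x S) j 0) else 0 else 0) +
      if w = x.succ then if (halfEdgesAt G x \ S).card = 1 then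
        cls K n (reconnect (split G x S) j x.succ) else 0 else 0 := by
  -- Only the valences of the two halves of `x` can fail. Reconnection adds one half-edge, at `w`,
  -- so `w` must be the deficient half, with exactly one old half-edge.
  have hcard : ¬ (2 ≤ S.card ∧ 2 ≤ (halfEdgesAt G x \ S).card) := fun hc =>
    hbad (hG.split hS hc.1 hc.2)
  have HS := H.split hS
  have h0 : (0 : Fin (N + 1)) ≠ x.succ := (Fin.succ_ne_zero x).symm
  by_cases hA : IsHairy (reconnect (split G x S) j w)
  · have t0 : 3 ≤ (halfEdgesAt (reconnect (split G x S) j w) 0).card := hA.trivalent 0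
    have t1 : 3 ≤ (halfEdgesAt (reconnect (split G x S) j w) x.succ).card := hA.trivalent x.succ
    by_cases hw0 : w = 0
    · subst hw0
      rw [halfEdgesAt_reconnect_self HS, Finset.card_insert_of_notMem (HS.notMem_halfEdgesAt _ _),
        card_halfEdgesAt_split_zero] at t0
      rw [halfEdgesAt_reconnect_of_ne _ _ h0, card_halfEdgesAt_split_self] at t1
      have : S.card = 1 := by omega
      simp [this, h0]
    · rw [halfEdgesAt_reconnect_of_ne _ _ hw0, card_halfEdgesAt_split_zero] at t0
      by_cases hwx : w = x.succ
      · subst hwx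
        rw [halfEdgesAt_reconnect_self HS, Finset.card_insert_of_notMem
          (HS.notMem_halfEdgesAt _ _), card_halfEdgesAt_split_self] at t1
        have : (halfEdgesAt G x \ S).card = 1 := by omega
        simp [this]
      · rw [halfEdgesAt_reconnect_of_ne _ _ hwx, card_halfEdgesAt_split_self] at t1
        omega
  · rw [cls_of_not_isHairy hA]
    by_cases hw0 : w = 0
    · subst hw0
      simp [cls_of_not_isHairy hA, h0]
    · by_cases hwx : w = x.succ
      · subst hwx
        simp [cls_of_not_isHairy hA]
      · simp [hw0, hwx]

-- The second term is the first one for the complement of `S`, so that summing over `S` gives the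
-- same sum twice. The conditions on `opp (p j)` express that the target is not the origin of the
-- hair.
open Classical in
theorem reconnectSplitSum_of_not_isHairy {G : LabelledGraph N (h + 1) k} (hG : IsHairy G)
    {p : Fin (h + 1) → Fin k × Bool} {u : Fin (h + 1) → Fin N} (H : HairData G p u)
    (j : Fin (h + 1)) {x : Fin N} {S : Finset (Fin k × Bool)} (hS : S ⊆ halfEdgesAt G x) :
    (if IsHairy (split G x S) then 0 else reconnectSplitSum K n G p u j x S) =
      (if S.card = 1 then if opp (p j) ∉ S then cls K n (reconnect (split G x S) j 0) else 0
        else 0) +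
      if (halfEdgesAt G x \ S).card = 1 then if opp (p j) ∉ halfEdgesAt G x \ S then
        cls K n (reconnect (split G x (halfEdgesAt G x \ S)) j 0) else 0 else 0 := by
  by_cases hs : IsHairy (split G x S)
  · have t0 : 3 ≤ (halfEdgesAt (split G x S) 0).card := hs.trivalent 0
    have t1 : 3 ≤ (halfEdgesAt (split G x S) x.succ).card := hs.trivalent x.succ
    rw [card_halfEdgesAt_split_zero] at t0
    rw [card_halfEdgesAt_split_self] at t1
    rw [if_pos hs, if_neg (by omega), if_neg (by omega), add_zero]
  · rw [if_neg hs, reconnectSplitSum, Finset.sum_congr rfl fun w _ =>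
      cls_reconnect_split_of_not_isHairy hG H j hS hs w, Finset.sum_add_distrib,
      Finset.sum_ite_eq', Finset.sum_ite_eq', cls_reconnect_split_compl j x hS]
    have h0 : 0 ∈ Finset.univ.filter (· ≠ if opp (p j) ∈ S then (0 : Fin (N + 1)) else (u j).succ) ↔
        opp (p j) ∉ S := by
      by_cases hq : opp (p j) ∈ S <;> simp [hq, (Fin.succ_ne_zero _).symm]
    have h1 : x.succ ∈ Finset.univ.filter
        (· ≠ if opp (p j) ∈ S then (0 : Fin (N + 1)) else (u j).succ) ↔
        opp (p j) ∉ halfEdgesAt G x \ S := by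
      rw [Finset.mem_sdiff, H.opp_mem_halfEdgesAt]
      by_cases hq : opp (p j) ∈ S <;> simp [hq, eq_comm]
    simp only [h0, h1]
    congr 1
    · split_ifs <;> rfl
    · split_ifs <;> rfl

theorem sum_powerset_sdiff {α M : Type*} [DecidableEq α] [AddCommMonoid M] (T : Finset α)
    (f : Finset α → M) : ∑ S ∈ T.powerset, f (T \ S) = ∑ S ∈ T.powerset, f S := by
  refine Finset.sum_bij' (fun S _ => T \ S) (fun S _ => T \ S) ?_ ?_ ?_ ?_ ?_
  · intro S _
    exact Finset.mem_powerset.2 Finset.sdiff_subset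
  · intro S _
    exact Finset.mem_powerset.2 Finset.sdiff_subset
  · intro S hS
    exact Finset.sdiff_sdiff_eq_self (Finset.mem_powerset.1 hS)
  · intro S hS
    exact Finset.sdiff_sdiff_eq_self (Finset.mem_powerset.1 hS)
  · intro S _
    rfl

open Classical in
/-- The terms that come from splittings with a vertex of valence two. -/
theorem sum_reconnectSplitSum_of_not_isHairy {G : LabelledGraph N (h + 1) k} (hG : IsHairy G)
    {p : Fin (h + 1) → Fin k × Bool} {u : Fin (h + 1) → Fin N} (H : HairData G p u) :
    ∑ x, ∑ S ∈ (halfEdgesAt G x).powerset, ∑ j, (reconnectSign n N k j : K) •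
      (if IsHairy (split G x S) then 0 else reconnectSplitSum K n G p u j x S) = 0 := by
  have h1 : ∀ x, ∑ S ∈ (halfEdgesAt G x).powerset, ∑ j, (reconnectSign n N k j : K) •
      (if S.card = 1 then if opp (p j) ∉ S then cls K n (reconnect (split G x S) j 0) else 0
        else 0) = ∑ r ∈ halfEdgesAt G x, ∑ j, (reconnectSign n N k j : K) •
      (if opp (p j) ≠ r then cls K n (reconnect (split G x {r}) j 0) else 0) := by
    intro x
    have h2 : ∀ S : Finset (Fin k × Bool), (∑ j, (reconnectSign n N k j : K) •
      (if S.card = 1 then if opp (p j) ∉ S then cls K n (reconnect (split G x S) j 0) else 0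
        else 0)) = if S.card = 1 then ∑ j, (reconnectSign n N k j : K) •
          (if opp (p j) ∉ S then cls K n (reconnect (split G x S) j 0) else 0) else 0 := by
      intro S
      split_ifs
      · rfl
      · simp
    simp only [h2]
    rw [← Finset.sum_filter, ← Finset.powersetCard_eq_filter, Finset.powersetCard_one,
      Finset.sum_map]
    simp
  have h3 : ∀ x, ∀ S ∈ (halfEdgesAt G x).powerset, ∑ j, (reconnectSign n N k j : K) •
      (if IsHairy (split G x S) then 0 else reconnectSplitSum K n G p u j x S) =
      (∑ j, (reconnectSign n N k j : K) • (if S.card = 1 then if opp (p j) ∉ S then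
        cls K n (reconnect (split G x S) j 0) else 0 else 0)) +
      ∑ j, (reconnectSign n N k j : K) • (if (halfEdgesAt G x \ S).card = 1 then
        if opp (p j) ∉ halfEdgesAt G x \ S then
        cls K n (reconnect (split G x (halfEdgesAt G x \ S)) j 0) else 0 else 0) := by
    intro x S hS
    rw [← Finset.sum_add_distrib]
    refine Finset.sum_congr rfl fun j _ => ?_
    rw [reconnectSplitSum_of_not_isHairy hG H j (Finset.mem_powerset.1 hS), smul_add]
  rw [Finset.sum_congr rfl fun x _ => Finset.sum_congr rfl (h3 x)]
  simp only [Finset.sum_add_distrib]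
  have h4 := fun x => sum_powerset_sdiff (halfEdgesAt G x) fun S =>
    ∑ j, (reconnectSign n N k j : K) • (if S.card = 1 then if opp (p j) ∉ S then
        cls K n (reconnect (split G x S) j 0) else 0 else 0)
  simp only [h4, h1, sum_attach H, add_zero]

/-- The hair end has to pass one more odd object: the new edge for even `n`, the new vertex for odd
`n`. -/
theorem reconnectSign_succ (n : ℤ) (N k : ℕ) (j : Fin h) :
    reconnectSign n (N + 1) (k + 1) j = - reconnectSign n N k j := by
  unfold reconnectSign
  split_ifs <;> ring

open Classical in
theorem Δgraph_cls_split {G : LabelledGraph N (h + 1) k}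
    {p : Fin (h + 1) → Fin k × Bool} {u : Fin (h + 1) → Fin N} (H : HairData G p u) {x : Fin N}
    {S : Finset (Fin k × Bool)} (hS : S ⊆ halfEdgesAt G x) :
    HGC.Δgraph K n (N + 1) h (k + 1) (cls K n (split G x S)) =
      - ∑ j, (reconnectSign n N k j : K) •
        (if IsHairy (split G x S) then reconnectSplitSum K n G p u j x S else 0) := by
  by_cases hs : IsHairy (split G x S)
  · rw [Δgraph_cls hs, reconnectSum_eq (H.split hS), ← Finset.sum_neg_distrib]
    refine Finset.sum_congr rfl fun j _ => ?_
    rw [if_pos hs, reconnectSplitSum, reconnectSign_succ, Finset.smul_sum,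
      ← Finset.sum_neg_distrib]
    simp only [Int.cast_neg, neg_smul]
  · simp [cls_of_not_isHairy hs, hs]

theorem δgraph_comp_Δgraph_add (K : Type*) [Field K] (n : ℤ) (N h k : ℕ) :
    HGC.δgraph K n N (h + 1) k ∘ₗ HGC.Δgraph K n N (h + 1) k +
      HGC.Δgraph K n (N + 1) (h + 1) (k + 1) ∘ₗ HGC.δgraph K n N (h + 2) k = 0 := by
  classical
  refine eq_zero_of_cls _ fun G hG => ?_
  rw [LinearMap.add_apply, LinearMap.comp_apply, LinearMap.comp_apply, Δgraph_cls hG, δgraph_cls]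
  rcases isEmpty_or_nonempty (Fin N) with hN | ⟨⟨v0⟩⟩
  · simp [reconnectSum_of_isEmpty, splitSum]
  obtain ⟨p, u, H⟩ := hG.exists_hairData v0
  have h1 : HGC.δgraph K n N (h + 1) k (reconnectSum K n G) = (1 / 2 : K) • ∑ x,
      ∑ S ∈ (halfEdgesAt G x).powerset, ∑ j,
        (reconnectSign n N k j : K) • reconnectSplitSum K n G p u j x S := by
    simp only [reconnectSum_eq H, map_sum, map_smul, δgraph_cls, splitSum]
    have h2 : ∀ j, (∑ v ∈ Finset.univ.filter (· ≠ u j), (reconnectSign n N k j : K) •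
        (1 / 2 : K) • ∑ x, ∑ S ∈ (halfEdgesAt (reconnect G j v) x).powerset,
          cls K n (split (reconnect G j v) x S)) = (1 / 2 : K) • ∑ x,
        ∑ S ∈ (halfEdgesAt G x).powerset,
          (reconnectSign n N k j : K) • reconnectSplitSum K n G p u j x S := by
      intro j
      simp only [smul_comm _ (1 / 2 : K), ← Finset.smul_sum]
      rw [Finset.sum_comm]
      simp only [sum_split_reconnect H]
    refine (Finset.sum_congr rfl fun j _ => h2 j).trans ?_
    rw [← Finset.smul_sum, Finset.sum_comm]
    refine congrArg _ (Finset.sum_congr rfl fun x _ => ?_)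
    rw [Finset.sum_comm]
  have h2 : HGC.Δgraph K n (N + 1) (h + 1) (k + 1) (splitSum K n G) = (1 / 2 : K) • ∑ x,
      ∑ S ∈ (halfEdgesAt G x).powerset, - ∑ j, (reconnectSign n N k j : K) •
        (if IsHairy (split G x S) then reconnectSplitSum K n G p u j x S else 0) := by
    simp only [splitSum, map_smul, map_sum]
    refine congrArg _ (Finset.sum_congr rfl fun x _ => Finset.sum_congr rfl fun S hS => ?_)
    exact Δgraph_cls_split H (Finset.mem_powerset.1 hS)
  rw [h1, h2, ← smul_add, ← Finset.sum_add_distrib]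
  convert smul_zero (1 / 2 : K)
  -- The sum over all splittings minus the sum over those inside the complex leaves exactly those
  -- outside it.
  refine Eq.trans ?_ (sum_reconnectSplitSum_of_not_isHairy (K := K) (n := n) hG H)
  refine Finset.sum_congr rfl fun x _ => ?_
  rw [← Finset.sum_add_distrib]
  refine Finset.sum_congr rfl fun S _ => ?_
  rw [← sub_eq_add_neg, ← Finset.sum_sub_distrib]
  refine Finset.sum_congr rfl fun j _ => ?_
  rw [← smul_sub]
  split_ifs <;> simp

end Anticommute

end HairyGraph

/-! ### The differential of the hairy graph complex -/

open HairyGraph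

namespace HGC

theorem Δ_comp_Δ (K : Type*) [Field K] (n d : ℤ) : Δ K n (d + 1) ∘ₗ Δ K n d = 0 := by
  refine LinearMap.ext fun x => ?_
  funext ⟨⟨N, h, k⟩, hd⟩
  rcases h with _ | h
  · rfl
  · exact LinearMap.congr_fun (Δgraph_comp_Δgraph K n N h k) _

theorem δ_comp_δ (K : Type*) [Field K] [CharZero K] (n d : ℤ) : δ K n (d + 1) ∘ₗ δ K n d = 0 := by
  refine LinearMap.ext fun x => ?_
  funext ⟨⟨N, h, k⟩, hd⟩
  -- The indices are those of the target. Two splittings add two vertices and two edges, so all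
  -- components except the last are zero by the default values in `δ`.
  rcases N with _ | _ | N <;> rcases k with _ | _ | k
  · rfl
  · rfl
  · rfl
  · rfl
  · exact map_zero (δgraph K n 0 h 0)
  · exact map_zero (δgraph K n 0 h (k + 1))
  · rfl
  · exact map_zero (δgraph K n (N + 1) h 0)
  · exact LinearMap.congr_fun (δgraph_comp_δgraph K n N h k) _

theorem δ_comp_Δ_add (K : Type*) [Field K] (n d : ℤ) :
    δ K n (d + 1) ∘ₗ Δ K n d + Δ K n (d + 1) ∘ₗ δ K n d = 0 := by
  refine LinearMap.ext fun x => ?_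
  funext ⟨⟨N, h, k⟩, hd⟩
  -- At `h = 0` each composite passes through a zero value of `Δ`, and at `N = 0` or `k = 0` through
  -- one of `δ`.
  rcases N with _ | N <;> rcases k with _ | k <;> rcases h with _ | h
  · exact add_zero (0 : GraphSpace K n 0 0 0)
  · exact (zero_add _).trans (map_zero (Δgraph K n 0 (h + 1) 0))
  · exact add_zero (0 : GraphSpace K n 0 0 (k + 1))
  · exact (zero_add _).trans (map_zero (Δgraph K n 0 (h + 1) (k + 1)))
  · exact add_zero (0 : GraphSpace K n (N + 1) 0 0)
  · exact (zero_add _).trans (map_zero (Δgraph K n (N + 1) (h + 1) 0))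
  · exact (add_zero _).trans (map_zero (δgraph K n N 0 k))
  · exact LinearMap.congr_fun (δgraph_comp_Δgraph_add K n N h k) _

end HGC

end

theorem mainTheorem3 (K : Type*) [Field K] [CharZero K] (n : ℤ) :
    (∀ d : ℤ, HGC.Δ K n (d + 1) ∘ₗ HGC.Δ K n d = 0) ∧
    (∀ d : ℤ, HGC.δ K n (d + 1) ∘ₗ HGC.Δ K n d + HGC.Δ K n (d + 1) ∘ₗ HGC.δ K n d = 0) ∧
    (∀ d : ℤ, (HGC.δ K n (d + 1) + HGC.Δ K n (d + 1)) ∘ₗ (HGC.δ K n d + HGC.Δ K n d) = 0) := by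
  refine ⟨HGC.Δ_comp_Δ K n, HGC.δ_comp_Δ_add K n, fun d => ?_⟩
  rw [LinearMap.add_comp, LinearMap.comp_add, LinearMap.comp_add, HGC.δ_comp_δ, HGC.Δ_comp_Δ,
    zero_add, add_zero, HGC.δ_comp_Δ_add]
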